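/- Let $\mathbb S$ be the affine group, i.e. $\mathbb R^2$ with coordinates $(a,\ell)$ and group law $(a,\ell)(a',\ell')=(a+a',e^{-2a'}\ell+\ell')$, and let $\mathfrak s=\mathbb RH\oplus\mathbb RE$, $[H,E]=2E$, be its Lie algebra, with left-invariant vector fields $\tilde H=\partial_a-2\ell\partial_\ell$ and $\tilde E=\partial_\ell$. On $G=\mathbb S\times\mathbb S$, with coordinates $(a_1,\ell_1,a_2,\ell_2)$ and left Haar measure $da_1\,d\ell_1\,da_2\,d\ell_2$, write $\tilde P$ for the left-invariant differential operator associated with $P\in\mathcal U(\mathfrak s\oplus\mathfrak s)$. For a nowhere vanishing ${\bf m}\in C^\infty(G,\mathbb C)$ let $\mathcal B^{\bf m}$ be the space of all $F\in C^\infty(G,\mathbb C)$ such that for every $P\in\mathcal U(\mathfrak s\oplus\mathfrak s)$ there is $C>0$ with $|\tilde PF|<C|{\bf m}|$ on $G$; ${\bf m}$ is a weight if ${\bf m}\in\mathcal B^{\bf m}$. For $S\in C^\infty(G,\mathbb R)$, put ${\bf m}_P:=e^{-iS}\tilde P e^{iS}$. The element $P$ is called $S$-adapted if ${\bf m}_P$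 is a weight and $1/{\bf m}_P$ is integrable on $G$; $S$ is called a phase if an $S$-adapted $P$ exists. If ${\bf m}_0$ is a weight with ${\bf m}_0/{\bf m}_P$ integrable on $G$, the elements of $\mathcal B^{{\bf m}_0}$ are called amplitudes (adapted to $S$, through $P$). Let $$S_{\rm can}:=\sinh(2a_1)\,\ell_2-\sinh(2a_2)\,\ell_1 .$$ (1) $S_{\rm can}$ is a phase on $\mathbb S\times\mathbb S$. (2) There is an $S_{\rm can}$-adapted $P$ such that, for every weight ${\bf m}_0={\bf m}_0(a_1,a_2)$ depending only on $(a_1,a_2)$ and satisfying $$\frac{{\bf m}_0}{\sqrt{\cosh(2(a_1-a_2))\cosh(4(a_1+a_2))\cosh(4(a_1-a_2))}}\in L^1(\mathbb R^2,da_1\,da_2),\qquad(*)$$ the function ${\bf m}_0/{\bf m}_P$ is integrable on $G$; that is, all elements of $\mathcal B^{{\bf m}_0}$, in particular ${\bf m}_0$ itself, are adapted amplitudes. (3) Let $\Delta=2(H^2+E^2-2H)$ be the hyperbolic Laplacian and ${\bf\Delta}=\Delta\otimes1+1\otimes\Delta$. There is a constant $C>0$ such that ${\bf m}_C:=e^{-iS_{\rm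 can}}(C+{\bf\Delta}^2)e^{iS_{\rm can}}$ vanishes nowhere, $1/{\bf m}_C$ is integrable on $G$, and ${\bf m}_0/{\bf m}_C$ is integrable on $G$ for every weight ${\bf m}_0={\bf m}_0(a_1,a_2)$ satisfying $(*)$. -/

import Mathlib

open MeasureTheory
open scoped ContDiff

noncomputable section

/-! ### The affine group and its Lie algebra -/

/-- The affine group `S`, in the global coordinates `(a, ℓ) ↦ exp (a H) exp (ℓ E)`. -/
abbrev Aff : Type := ℝ × ℝ

namespace Aff

/-- The group law `(a, ℓ) (a', ℓ') = (a + a', e^{-2a'} ℓ + ℓ')`. -/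
def mul (x y : Aff) : Aff := (x.1 + y.1, Real.exp (-2 * y.1) * x.2 + y.2)

/-- The inverse `(a, ℓ)⁻¹ = (-a, -e^{2a} ℓ)`; the neutral element is `(0, 0)`. -/
def inv (x : Aff) : Aff := (-x.1, -(Real.exp (2 * x.1) * x.2))

theorem mul_assoc (x y z : Aff) : mul (mul x y) z = mul x (mul y z) := by
  have h : Real.exp (-2 * (y.1 + z.1)) = Real.exp (-2 * y.1) * Real.exp (-2 * z.1) := by
    rw [← Real.exp_add]; congr 1; ring
  ext
  · simp only [mul]; ring
  · simp only [mul, h]; ring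

theorem zero_mul (x : Aff) : mul 0 x = x := by ext <;> simp [mul]

theorem mul_zero (x : Aff) : mul x 0 = x := by ext <;> simp [mul]

theorem inv_mul (x : Aff) : mul (inv x) x = 0 := by
  have h : Real.exp (-2 * x.1) * Real.exp (2 * x.1) = 1 := by
    rw [← Real.exp_add]; simp
  ext
  · simp [mul, inv]
  · simp only [mul, inv, Prod.snd_zero]
    linear_combination (-x.2) * h

end Aff

/-- The Lie algebra `s` of the affine group: `(h, e)` stands for `h H + e E`, with `[H, E] = 2 E`. -/
def AffAlg : Type := ℝ × ℝ

namespace AffAlg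

instance : AddCommGroup AffAlg := inferInstanceAs (AddCommGroup (ℝ × ℝ))

instance : Module ℝ AffAlg := inferInstanceAs (Module ℝ (ℝ × ℝ))

instance : Bracket AffAlg AffAlg := ⟨fun X Y => ((0 : ℝ), 2 * (X.1 * Y.2 - Y.1 * X.2))⟩

theorem bracket_def (X Y : AffAlg) :
    ⁅X, Y⁆ = (((0 : ℝ), 2 * (X.1 * Y.2 - Y.1 * X.2)) : ℝ × ℝ) := rfl

theorem add_fst (X Y : AffAlg) : (X + Y).1 = X.1 + Y.1 := rfl

theorem add_snd (X Y : AffAlg) : (X + Y).2 = X.2 + Y.2 := rfl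

theorem smul_fst (c : ℝ) (X : AffAlg) : (c • X).1 = c * X.1 := rfl

theorem smul_snd (c : ℝ) (X : AffAlg) : (c • X).2 = c * X.2 := rfl

theorem bracket_fst (X Y : AffAlg) : ⁅X, Y⁆.1 = (0 : ℝ) := rfl

theorem bracket_snd (X Y : AffAlg) : ⁅X, Y⁆.2 = 2 * (X.1 * Y.2 - Y.1 * X.2) := rfl

instance : LieRing AffAlg where
  add_lie X Y Z := Prod.ext (by simp only [add_fst, bracket_fst]; ring)
    (by simp only [add_fst, add_snd, bracket_snd]; ring)
  lie_add X Y Z := Prod.ext (by simp only [add_fst, bracket_fst]; ring)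
    (by simp only [add_fst, add_snd, bracket_snd]; ring)
  lie_self X := Prod.ext rfl (by rw [bracket_snd]; change _ = (0 : ℝ); ring)
  leibniz_lie X Y Z := Prod.ext (by simp only [add_fst, bracket_fst]; ring)
    (by simp only [add_snd, bracket_fst, bracket_snd]; ring)

instance : LieAlgebra ℝ AffAlg where
  lie_smul c X Y := Prod.ext (by simp only [smul_fst, bracket_fst]; ring)
    (by simp only [smul_fst, smul_snd, bracket_snd]; ring)

/-- The generator `H`. -/
def H : AffAlg := ((1 : ℝ), (0 : ℝ))

/-- The generator `E`. -/
def E : AffAlg := ((0 : ℝ), (1 : ℝ))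

theorem lie_H_E : ⁅H, E⁆ = (2 : ℝ) • E :=
  Prod.ext (by rw [smul_fst, bracket_fst]; simp [E])
    (by rw [smul_snd, bracket_snd]; simp [H, E])

end AffAlg

/-! ### The group `S × S` -/

/-- The group `S × S`, with points `((a₁, ℓ₁), (a₂, ℓ₂))`. -/
abbrev AffSq : Type := Aff × Aff

/-- The Lie algebra `s ⊕ s` of `S × S`. -/
abbrev AffSqAlg : Type := AffAlg × AffAlg

namespace AffSq

/-- The group law of `S × S`. -/
def mul (x y : AffSq) : AffSq := (Aff.mul x.1 y.1, Aff.mul x.2 y.2)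

/-- The left-invariant vector field of `X = ((h₁, e₁), (h₂, e₂))`; thus
`H̃ = ∂_a - 2 ℓ ∂_ℓ` and `Ẽ = ∂_ℓ` on each factor. -/
def field (X : AffSqAlg) (x : AffSq) : AffSq :=
  ((X.1.1, X.1.2 - 2 * X.1.1 * x.1.2), (X.2.1, X.2.2 - 2 * X.2.1 * x.2.2))

/-- The vector field `field X` is left-invariant with value `X` at the neutral element: its value
at `x` is the tangent vector at `t = 0` of the curve `t ↦ x · (t X)`, in coordinates. -/
theorem hasDerivAt_mul (X : AffSqAlg) (x : AffSq) :
    HasDerivAt (fun t : ℝ => mul x ((t * X.1.1, t * X.1.2), (t * X.2.1, t * X.2.2)))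
      (field X x) 0 := by
  have key : ∀ (c h e : ℝ),
      HasDerivAt (fun t : ℝ => Real.exp (-2 * (t * h)) * c + t * e) (e - 2 * h * c) 0 := by
    intro c h e
    have h1 : HasDerivAt (fun t : ℝ => -2 * (t * h)) (-2 * (1 * h)) 0 :=
      ((hasDerivAt_id (0 : ℝ)).mul_const h).const_mul (-2)
    have h2 := (h1.exp.mul_const c).add ((hasDerivAt_id (0 : ℝ)).mul_const e)
    refine h2.congr_deriv ?_
    simp; ring
  have key' : ∀ (c h : ℝ), HasDerivAt (fun t : ℝ => c + t * h) h 0 := by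
    intro c h
    have h1 := ((hasDerivAt_id (0 : ℝ)).mul_const h).const_add c
    exact h1.congr_deriv (by simp)
  exact ((key' _ _).prodMk (key _ _ _)).prodMk ((key' _ _).prodMk (key _ _ _))

/-- Lebesgue measure `da₁ dℓ₁ da₂ dℓ₂` is a left-invariant Haar measure on `S × S`. -/
theorem measurePreserving_mul (x : AffSq) :
    MeasurePreserving (mul x) (volume : Measure AffSq) volume := by
  have key : ∀ y : Aff, MeasurePreserving (Aff.mul y) (volume : Measure (ℝ × ℝ)) volume := by
    intro y
    have hm : Measurable (Function.uncurry
        (fun a l : ℝ => Real.exp (-2 * a) * y.2 + l)) := by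
      apply Continuous.measurable
      simp only [Function.uncurry_def]
      fun_prop
    exact (measurePreserving_add_left volume y.1).skew_product hm
      (Filter.Eventually.of_forall fun a =>
        (measurePreserving_add_left volume (Real.exp (-2 * a) * y.2)).map_eq)
  exact (key x.1).prod (key x.2)

/-! ### Left-invariant differential operators -/

/-- The space `C^∞(S × S, ℂ)`. -/
def Smooth : Submodule ℝ (AffSq → ℂ) where
  carrier := {F | ContDiff ℝ ∞ F}
  add_mem' {F G} hF hG := by
    change ContDiff ℝ ∞ F at hF
    change ContDiff ℝ ∞ G at hG
    exact hF.add hG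
  zero_mem' := by
    change ContDiff ℝ ∞ (fun _ : AffSq => (0 : ℂ))
    exact contDiff_const
  smul_mem' c F hF := by
    change ContDiff ℝ ∞ F at hF
    exact hF.const_smul c

theorem contDiff_coe (F : Smooth) : ContDiff ℝ ∞ F.1 := F.2

theorem contDiff_field (X : AffSqAlg) : ContDiff ℝ ∞ (field X) := by
  unfold field
  fun_prop

theorem contDiff_fderiv_field (X : AffSqAlg) {F : AffSq → ℂ} (hF : ContDiff ℝ ∞ F) :
    ContDiff ℝ ∞ (fun x => fderiv ℝ F x (field X x)) :=
  (hF.fderiv_right (by norm_num)).clm_apply (contDiff_field X)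

/-- The derivation `F ↦ X̃ F` of `C^∞(S × S, ℂ)` given by the left-invariant vector field of `X`. -/
def leftDeriv (X : AffSqAlg) : Module.End ℝ Smooth where
  toFun F := ⟨fun x => fderiv ℝ F.1 x (field X x), contDiff_fderiv_field X (contDiff_coe F)⟩
  map_add' F G := by
    ext x
    have hF : DifferentiableAt ℝ F.1 x := (contDiff_coe F).differentiable (by simp) x
    have hG : DifferentiableAt ℝ G.1 x := (contDiff_coe G).differentiable (by simp) x
    change fderiv ℝ (F.1 + G.1) x (field X x) = _
    rw [fderiv_add hF hG]
    rfl
  map_smul' c F := by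
    ext x
    have hF : DifferentiableAt ℝ F.1 x := (contDiff_coe F).differentiable (by simp) x
    change fderiv ℝ (c • F.1) x (field X x) = _
    rw [fderiv_const_smul hF]
    rfl

theorem leftDeriv_apply (X : AffSqAlg) (F : Smooth) (x : AffSq) :
    (leftDeriv X F).1 x = fderiv ℝ F.1 x (field X x) := rfl

/-- The linear part of the vector field `field X`, i.e. its derivative at any point. -/
def fieldDeriv (X : AffSqAlg) : AffSq →L[ℝ] AffSq :=
  LinearMap.toContinuousLinearMap
    { toFun := fun v => ((0, -(2 * X.1.1 * v.1.2)), (0, -(2 * X.2.1 * v.2.2)))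
      map_add' := fun v w => by ext <;> simp <;> ring
      map_smul' := fun c v => by ext <;> simp <;> ring }

theorem fieldDeriv_apply (X : AffSqAlg) (v : AffSq) :
    fieldDeriv X v = ((0, -(2 * X.1.1 * v.1.2)), (0, -(2 * X.2.1 * v.2.2))) := rfl

theorem hasFDerivAt_field (X : AffSqAlg) (x : AffSq) :
    HasFDerivAt (field X) (fieldDeriv X) x := by
  have h : field X = fun y => field X 0 + fieldDeriv X y := by
    funext y
    ext <;> simp [field, fieldDeriv_apply] <;> ring
  rw [h]
  exact (fieldDeriv X).hasFDerivAt.const_add _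

theorem leftDeriv_leftDeriv (X Y : AffSqAlg) (F : Smooth) (x : AffSq) :
    (leftDeriv X (leftDeriv Y F)).1 x =
      fderiv ℝ (fderiv ℝ F.1) x (field X x) (field Y x) +
        fderiv ℝ F.1 x (fieldDeriv Y (field X x)) := by
  have h1 : DifferentiableAt ℝ (fderiv ℝ F.1) x :=
    ((contDiff_coe F).fderiv_right (m := ∞) (by norm_num)).differentiable (by simp) x
  have h2 := h1.hasFDerivAt.clm_apply (hasFDerivAt_field Y x)
  rw [leftDeriv_apply]
  change fderiv ℝ (fun y => fderiv ℝ F.1 y (field Y y)) x (field X x) = _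
  rw [h2.fderiv]
  simp [add_comm]

attribute [local instance] LieRing.ofAssociativeRing

/-- Left-invariant vector fields represent the Lie algebra `s ⊕ s` on `C^∞(S × S, ℂ)`. -/
def leftDerivHom : AffSqAlg →ₗ⁅ℝ⁆ Module.End ℝ Smooth where
  toFun := leftDeriv
  map_add' X Y := by
    ext F x
    change fderiv ℝ F.1 x (field (X + Y) x) =
      fderiv ℝ F.1 x (field X x) + fderiv ℝ F.1 x (field Y x)
    rw [← map_add]
    congr 1
    ext <;> simp [field, AffAlg.add_fst, AffAlg.add_snd] <;> ring
  map_smul' c X := by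
    ext F x
    change fderiv ℝ F.1 x (field (c • X) x) = c • fderiv ℝ F.1 x (field X x)
    rw [← map_smul]
    congr 1
    ext <;> simp [field, AffAlg.smul_fst, AffAlg.smul_snd] <;> ring
  map_lie' {X Y} := by
    ext F x
    change fderiv ℝ F.1 x (field ⁅X, Y⁆ x) =
      (leftDeriv X (leftDeriv Y F)).1 x - (leftDeriv Y (leftDeriv X F)).1 x
    have hs : IsSymmSndFDerivAt ℝ F.1 x :=
      ((contDiff_coe F).contDiffAt (x := x)).isSymmSndFDerivAt (by
        rw [minSmoothness_of_isRCLikeNormedField]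
        exact WithTop.coe_le_coe.2 le_top)
    rw [leftDeriv_leftDeriv, leftDeriv_leftDeriv, hs.eq (field X x) (field Y x),
      add_sub_add_left_eq_sub, ← map_sub]
    congr 1
    ext <;> simp [field, fieldDeriv_apply, AffAlg.bracket_fst, AffAlg.bracket_snd] <;> ring

/-- The universal enveloping algebra `U(s ⊕ s)`. -/
abbrev Env : Type := UniversalEnvelopingAlgebra ℝ AffSqAlg

/-- The left-invariant differential operator `P̃` on `C^∞(S × S, ℂ)` associated with `P`. -/
def leftOp : Env →ₐ[ℝ] Module.End ℝ Smooth :=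
  UniversalEnvelopingAlgebra.lift ℝ leftDerivHom

theorem leftOp_ι (X : AffSqAlg) (F : Smooth) (x : AffSq) :
    (leftOp (UniversalEnvelopingAlgebra.ι ℝ X) F).1 x = fderiv ℝ F.1 x (field X x) := by
  rw [leftOp, UniversalEnvelopingAlgebra.lift_ι_apply]
  rfl

/-! ### Weights, phases and amplitudes -/

/-- The space `B^m` of smooth functions `F : S × S → ℂ` all of whose left-invariant derivatives
are bounded by a multiple of `|m|`. -/
def symbolSpace (m : AffSq → ℂ) : Set Smooth :=
  {F | ∀ P : Env, ∃ C : ℝ, 0 < C ∧ ∀ x, ‖(leftOp P F).1 x‖ < C * ‖m x‖}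

/-- A weight: a nowhere vanishing smooth function `m` with `m ∈ B^m`. -/
def IsWeight (m : AffSq → ℂ) : Prop :=
  (∀ x, m x ≠ 0) ∧ ∃ hm : ContDiff ℝ ∞ m, (⟨m, hm⟩ : Smooth) ∈ symbolSpace m

/-- The space `C^∞(S × S, ℝ)`. -/
abbrev RealSmooth : Type := {S : AffSq → ℝ // ContDiff ℝ ∞ S}

/-- The smooth function `e^{iS}`. -/
def expI (S : RealSmooth) : Smooth :=
  ⟨fun x => Complex.exp (Complex.I * (S.1 x : ℂ)),
    (contDiff_const.mul (Complex.ofRealCLM.contDiff.comp S.2)).cexp⟩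

/-- The function `m_P = e^{-iS} P̃ e^{iS}`. -/
def mult (S : RealSmooth) (P : Env) (x : AffSq) : ℂ :=
  Complex.exp (-(Complex.I * (S.1 x : ℂ))) * (leftOp P (expI S)).1 x

/-- `P` is `S`-adapted: `m_P` is a weight with integrable inverse. -/
def IsAdapted (S : RealSmooth) (P : Env) : Prop :=
  IsWeight (mult S P) ∧ Integrable (fun x => 1 / mult S P x)

/-- `S` is a phase: there is an `S`-adapted `P`. -/
def IsPhase (S : RealSmooth) : Prop := ∃ P, IsAdapted S P

/-- `m₀` is a weight for which `m₀ / m_P` is integrable. The elements of `B^{m₀}` are then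
amplitudes adapted to `S`. -/
def IsAmplitudeWeight (S : RealSmooth) (P : Env) (m₀ : AffSq → ℂ) : Prop :=
  IsWeight m₀ ∧ Integrable (fun x => m₀ x / mult S P x)

/-- An amplitude adapted to `S`, through the operator `P`. -/
def IsAmplitude (S : RealSmooth) (P : Env) (A : Smooth) : Prop :=
  ∃ m₀, IsAmplitudeWeight S P m₀ ∧ A ∈ symbolSpace m₀

/-! ### The canonical two-point function and the hyperbolic Laplacian -/

/-- `S_can = sinh (2 a₁) ℓ₂ - sinh (2 a₂) ℓ₁`. -/
def Scan : RealSmooth :=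
  ⟨fun x => Real.sinh (2 * x.1.1) * x.2.2 - Real.sinh (2 * x.2.1) * x.1.2, by fun_prop⟩

/-- The element of `U(s ⊕ s)` given by `X` in the first factor. -/
def inl (X : AffAlg) : Env := UniversalEnvelopingAlgebra.ι ℝ ((X, 0) : AffSqAlg)

/-- The element of `U(s ⊕ s)` given by `X` in the second factor. -/
def inr (X : AffAlg) : Env := UniversalEnvelopingAlgebra.ι ℝ ((0, X) : AffSqAlg)

/-- `Δ ⊗ 1 + 1 ⊗ Δ`, where `Δ = 2 (H² + E² - 2 H)` is the hyperbolic Laplacian. -/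
def laplacian : Env :=
  (2 : ℝ) • (inl AffAlg.H ^ 2 + inl AffAlg.E ^ 2 - (2 : ℝ) • inl AffAlg.H) +
    (2 : ℝ) • (inr AffAlg.H ^ 2 + inr AffAlg.E ^ 2 - (2 : ℝ) • inr AffAlg.H)

/-- The condition on a function `w (a₁, a₂)`, for `a = (a₁, a₂)`: its quotient by
`√(cosh (2 (a₁ - a₂)) cosh (4 (a₁ + a₂)) cosh (4 (a₁ - a₂)))` is integrable on the plane. -/
def IntegrabilityCondition (w : ℝ × ℝ → ℂ) : Prop :=
  Integrable (fun a : ℝ × ℝ => w a / ((Real.sqrt (Real.cosh (2 * (a.1 - a.2)) *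
    Real.cosh (4 * (a.1 + a.2)) * Real.cosh (4 * (a.1 - a.2))) : ℝ) : ℂ))

end AffSq

end

/-!
Write `H_j`, `E_j` for the generators of the two factors. Conjugation by `e^{iS}` turns a
left-invariant field `X̃` into `X̃ + i X̃(S)` (`mult_ι_mul`), so multipliers are computed by iterating
this first order operator on the constant `1`. For the canonical phase everything is expressed
through `e^{±2a_j}` and the three functions

* `p = e^{2a₁} ℓ₂ + e^{2a₂} ℓ₁`, `q = e^{2a₁} ℓ₂ - e^{2a₂} ℓ₁`, `r = e^{-2a₁} ℓ₂ - e^{-2a₂} ℓ₁`,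

which span, together with the `e^{±2a_j}`, a space stable under all left-invariant fields. With
`A = (H₁ + H₂) / 2` and `B = (H₁ - H₂) / 2` one has `A S = r`, `B S = p`, `A r = -2 r`, `A p = 0`,
`B r = 0`, `B p = 2 q`, and `S = (q - r) / 2`.

The operator `A (A + 2) (A + 4) (A + 6) - B² + (1 - E₁² - E₂²)⁴` has the multiplier
`r⁴ + p² - 2 i q + D⁴`, where `D = 1 + sinh² (2a₁) + sinh² (2a₂)` (`mult_adaptedOp`). Its modulus is at
least `f = p² + r⁴ + D⁴`. It is a weight: give `e^{±2a_j}`, `r`, `p`, `q` the degrees `1, 2, 4, 4`.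
Left-invariant fields do not raise degrees, and a polynomial of degree `d` is bounded by a multiple
of `f^{d/8}` (`IsSymbol.norm_le`). The one bound that is not immediate is that of `q`, which follows
from `q cosh (2 (a₁ - a₂)) = p sinh (2 (a₁ - a₂)) + r e^{2 (a₁ + a₂)}` (`qFun_sq_le`).

For the squared Laplacian, put `Z = D + 2 p² + 2 r²`. Its multiplier is
`4 Z² - 192 q² + 256 q r - i q (192 p² + 64 r² + 32 D - 160)` up to terms `O(Z)` in the real part and
`O(Z^{3/2})` in the imaginary part (`exists_mult_laplacian_sq`). The real part can only be small when
`|q|` is at least a multiple of `Z + √C`. As `|q|` is `O(Z^{3/2})`, for large `C` this forces `Z` to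
be large, and then the imaginary part is at least a multiple of `|q| Z` (`half_sq_le_abs_or`). So
the modulus of the multiplier of `C + L²` is at least `Z² / 2`.

For integrability, `(ℓ₁, ℓ₂) ↦ (p, r)` is, for fixed `(a₁, a₂)`, a linear change of variables of
determinant `2 cosh (2 (a₁ - a₂))`. Both `1 / f` and `1 / Z²` have integral `O(1 / D)` over the
`(p, r)`-plane, and `2 D cosh (2 (a₁ - a₂))` dominates the square root in the integrability condition
(`integrable_div`, `sqrt_cosh_le`). The constant `1` satisfies that condition, which gives the
integrability of the inverse multipliers.
-/

namespace AffSq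

/-! ### Derivatives along left-invariant vector fields -/

/-- `HasFieldDeriv X F F'` says that the function `F` is smooth and that its derivative along the
left-invariant vector field of `X` is `F'`. -/
structure HasFieldDeriv (X : AffSqAlg) (F F' : AffSq → ℂ) : Prop where
  contDiff : ContDiff ℝ ∞ F
  fderiv_field : ∀ x, fderiv ℝ F x (field X x) = F' x

namespace HasFieldDeriv

variable {X : AffSqAlg} {F F' G G' : AffSq → ℂ}

theorem differentiable (h : HasFieldDeriv X F F') : Differentiable ℝ F :=
  h.contDiff.differentiable (by simp)

theorem congr (h : HasFieldDeriv X F F') (hF : G = F) (hF' : G' = F') : HasFieldDeriv X G G' := by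
  rw [hF, hF']; exact h

theorem const (X : AffSqAlg) (c : ℂ) : HasFieldDeriv X (fun _ => c) (fun _ => 0) :=
  ⟨contDiff_const, fun x => by simp⟩

theorem add (hF : HasFieldDeriv X F F') (hG : HasFieldDeriv X G G') :
    HasFieldDeriv X (fun x => F x + G x) (fun x => F' x + G' x) :=
  ⟨hF.contDiff.add hG.contDiff, fun x => by
    rw [fderiv_fun_add (hF.differentiable x) (hG.differentiable x), ← hF.fderiv_field,
      ← hG.fderiv_field]
    rfl⟩

theorem mul (hF : HasFieldDeriv X F F') (hG : HasFieldDeriv X G G') :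
    HasFieldDeriv X (fun x => F x * G x) (fun x => F' x * G x + F x * G' x) :=
  ⟨hF.contDiff.mul hG.contDiff, fun x => by
    rw [fderiv_fun_mul (hF.differentiable x) (hG.differentiable x), ← hF.fderiv_field,
      ← hG.fderiv_field]
    simp only [add_apply, smul_apply, smul_eq_mul]
    ring⟩

theorem const_mul (hF : HasFieldDeriv X F F') (c : ℂ) :
    HasFieldDeriv X (fun x => c * F x) (fun x => c * F' x) :=
  ((const X c).mul hF).congr rfl (by funext x; ring)

theorem sub (hF : HasFieldDeriv X F F') (hG : HasFieldDeriv X G G') :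
    HasFieldDeriv X (fun x => F x - G x) (fun x => F' x - G' x) :=
  (hF.add (hG.const_mul (-1))).congr (by funext x; ring) (by funext x; ring)

theorem sq (hF : HasFieldDeriv X F F') :
    HasFieldDeriv X (fun x => F x ^ 2) (fun x => 2 * F x * F' x) :=
  (hF.mul hF).congr (by funext x; ring) (by funext x; ring)

theorem ofReal {f : AffSq → ℝ} {f' : AffSq → AffSq →L[ℝ] ℝ} (hf : ContDiff ℝ ∞ f)
    (h : ∀ x, HasFDerivAt f (f' x) x) :
    HasFieldDeriv X (fun x => (f x : ℂ)) (fun x => ((f' x (field X x) : ℝ) : ℂ)) :=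
  ⟨Complex.ofRealCLM.contDiff.comp hf, fun x => by
    have := (Complex.ofRealCLM.hasFDerivAt.comp x (h x)).fderiv
    change fderiv ℝ (Complex.ofRealCLM ∘ f) x _ = _
    rw [this]
    rfl⟩

end HasFieldDeriv

/-! ### The functions through which the phase factors -/

/-- `e^{2 c a₁}`, as a complex-valued function. -/
noncomputable def exp₁ (c : ℝ) (x : AffSq) : ℂ := (Real.exp (2 * c * x.1.1) : ℝ)

/-- `e^{2 c a₂}`, as a complex-valued function. -/
noncomputable def exp₂ (c : ℝ) (x : AffSq) : ℂ := (Real.exp (2 * c * x.2.1) : ℝ)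

/-- `p = e^{2a₁} ℓ₂ + e^{2a₂} ℓ₁`, half of the derivative of the phase along `H₁ - H₂`. -/
noncomputable def pFun (x : AffSq) : ℝ := Real.exp (2 * x.1.1) * x.2.2 + Real.exp (2 * x.2.1) * x.1.2

/-- `q = e^{2a₁} ℓ₂ - e^{2a₂} ℓ₁`, half of the derivative of `p` along `H₁`. -/
noncomputable def qFun (x : AffSq) : ℝ := Real.exp (2 * x.1.1) * x.2.2 - Real.exp (2 * x.2.1) * x.1.2

/-- `r = e^{-2a₁} ℓ₂ - e^{-2a₂} ℓ₁`, half of the derivative of the phase along `H₁ + H₂`. -/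
noncomputable def rFun (x : AffSq) : ℝ :=
  Real.exp (-(2 * x.1.1)) * x.2.2 - Real.exp (-(2 * x.2.1)) * x.1.2

/-- `D = 1 + sinh² (2a₁) + sinh² (2a₂)`. -/
noncomputable def dFun (a : ℝ × ℝ) : ℝ := 1 + Real.sinh (2 * a.1) ^ 2 + Real.sinh (2 * a.2) ^ 2

theorem hasFieldDeriv_exp₁ (X : AffSqAlg) (c : ℝ) :
    HasFieldDeriv X (exp₁ c) (fun x => 2 * c * X.1.1 * exp₁ c x) := by
  let π₁ : AffSq →L[ℝ] ℝ :=
    (ContinuousLinearMap.fst ℝ ℝ ℝ).comp (ContinuousLinearMap.fst ℝ (ℝ × ℝ) (ℝ × ℝ))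
  refine (HasFieldDeriv.ofReal (f := fun x : AffSq => Real.exp (2 * c * x.1.1)) (by fun_prop)
    fun x => ((π₁.hasFDerivAt (x := x)).const_mul (2 * c)).exp).congr rfl ?_
  funext x
  simp [π₁, exp₁, field]
  ring

theorem hasFieldDeriv_exp₂ (X : AffSqAlg) (c : ℝ) :
    HasFieldDeriv X (exp₂ c) (fun x => 2 * c * X.2.1 * exp₂ c x) := by
  let π₂ : AffSq →L[ℝ] ℝ :=
    (ContinuousLinearMap.fst ℝ ℝ ℝ).comp (ContinuousLinearMap.snd ℝ (ℝ × ℝ) (ℝ × ℝ))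
  refine (HasFieldDeriv.ofReal (f := fun x : AffSq => Real.exp (2 * c * x.2.1)) (by fun_prop)
    fun x => ((π₂.hasFDerivAt (x := x)).const_mul (2 * c)).exp).congr rfl ?_
  funext x
  simp [π₂, exp₂, field]
  ring

theorem hasFieldDeriv_ell₁ (X : AffSqAlg) :
    HasFieldDeriv X (fun x => (x.1.2 : ℂ)) (fun x => X.1.2 - 2 * X.1.1 * x.1.2) := by
  let π₁ : AffSq →L[ℝ] ℝ :=
    (ContinuousLinearMap.snd ℝ ℝ ℝ).comp (ContinuousLinearMap.fst ℝ (ℝ × ℝ) (ℝ × ℝ))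
  refine (HasFieldDeriv.ofReal (f := fun x : AffSq => x.1.2) (by fun_prop)
    fun x => (π₁.hasFDerivAt (x := x))).congr rfl ?_
  funext x
  simp [π₁, field]

theorem hasFieldDeriv_ell₂ (X : AffSqAlg) :
    HasFieldDeriv X (fun x => (x.2.2 : ℂ)) (fun x => X.2.2 - 2 * X.2.1 * x.2.2) := by
  let π₂ : AffSq →L[ℝ] ℝ :=
    (ContinuousLinearMap.snd ℝ ℝ ℝ).comp (ContinuousLinearMap.snd ℝ (ℝ × ℝ) (ℝ × ℝ))
  refine (HasFieldDeriv.ofReal (f := fun x : AffSq => x.2.2) (by fun_prop)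
    fun x => (π₂.hasFDerivAt (x := x))).congr rfl ?_
  funext x
  simp [π₂, field]

theorem ofReal_pFun (x : AffSq) : (pFun x : ℂ) = exp₁ 1 x * x.2.2 + exp₂ 1 x * x.1.2 := by
  simp [pFun, exp₁, exp₂]

theorem ofReal_qFun (x : AffSq) : (qFun x : ℂ) = exp₁ 1 x * x.2.2 - exp₂ 1 x * x.1.2 := by
  simp [qFun, exp₁, exp₂]

theorem ofReal_rFun (x : AffSq) : (rFun x : ℂ) = exp₁ (-1) x * x.2.2 - exp₂ (-1) x * x.1.2 := by
  simp [rFun, exp₁, exp₂]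

theorem ofReal_sinh₁ (x : AffSq) :
    ((Real.sinh (2 * x.1.1) : ℝ) : ℂ) = (exp₁ 1 x - exp₁ (-1) x) / 2 := by
  simp [Real.sinh_eq, exp₁]

theorem ofReal_sinh₂ (x : AffSq) :
    ((Real.sinh (2 * x.2.1) : ℝ) : ℂ) = (exp₂ 1 x - exp₂ (-1) x) / 2 := by
  simp [Real.sinh_eq, exp₂]

theorem hasFieldDeriv_pFun (X : AffSqAlg) : HasFieldDeriv X (fun x => (pFun x : ℂ))
    (fun x => 2 * (X.1.1 - X.2.1) * qFun x + X.1.2 * exp₂ 1 x + X.2.2 * exp₁ 1 x) :=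
  (((hasFieldDeriv_exp₁ X 1).mul (hasFieldDeriv_ell₂ X)).add
    ((hasFieldDeriv_exp₂ X 1).mul (hasFieldDeriv_ell₁ X))).congr
    (funext ofReal_pFun) (by funext x; rw [ofReal_qFun]; push_cast; ring)

theorem hasFieldDeriv_qFun (X : AffSqAlg) : HasFieldDeriv X (fun x => (qFun x : ℂ))
    (fun x => 2 * (X.1.1 - X.2.1) * pFun x - X.1.2 * exp₂ 1 x + X.2.2 * exp₁ 1 x) :=
  (((hasFieldDeriv_exp₁ X 1).mul (hasFieldDeriv_ell₂ X)).sub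
    ((hasFieldDeriv_exp₂ X 1).mul (hasFieldDeriv_ell₁ X))).congr
    (funext ofReal_qFun) (by funext x; rw [ofReal_pFun]; push_cast; ring)

theorem hasFieldDeriv_rFun (X : AffSqAlg) : HasFieldDeriv X (fun x => (rFun x : ℂ))
    (fun x => -2 * (X.1.1 + X.2.1) * rFun x - X.1.2 * exp₂ (-1) x + X.2.2 * exp₁ (-1) x) :=
  (((hasFieldDeriv_exp₁ X (-1)).mul (hasFieldDeriv_ell₂ X)).sub
    ((hasFieldDeriv_exp₂ X (-1)).mul (hasFieldDeriv_ell₁ X))).congr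
    (funext ofReal_rFun) (by funext x; rw [ofReal_rFun]; push_cast; ring)

/-- The derivative of the canonical phase along the vector field of `X`. -/
noncomputable def phaseDeriv (X : AffSqAlg) (x : AffSq) : ℂ :=
  X.1.1 * (pFun x + rFun x) + X.2.1 * (rFun x - pFun x)
    - X.1.2 * ((exp₂ 1 x - exp₂ (-1) x) / 2) + X.2.2 * ((exp₁ 1 x - exp₁ (-1) x) / 2)

theorem Scan_eq (x : AffSq) : Scan.1 x = (qFun x - rFun x) / 2 := by
  simp only [Scan, qFun, rFun, Real.sinh_eq]
  ring

theorem hasFieldDeriv_Scan (X : AffSqAlg) :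
    HasFieldDeriv X (fun x => (Scan.1 x : ℂ)) (phaseDeriv X) :=
  (((hasFieldDeriv_qFun X).sub (hasFieldDeriv_rFun X)).const_mul (1 / 2)).congr
    (by funext x; rw [Scan_eq]; push_cast; ring) (by funext x; simp only [phaseDeriv]; ring)

/-! ### Conjugation of differential operators by the phase -/

theorem mult_one : mult Scan 1 = fun _ => 1 := by
  funext x
  simp only [mult, map_one, expI]
  change _ * Complex.exp _ = 1
  rw [← Complex.exp_add]
  simp

theorem mult_add (P Q : Env) : mult Scan (P + Q) = fun x => mult Scan P x + mult Scan Q x := by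
  funext x
  simp only [mult, map_add]
  exact mul_add _ _ _

theorem mult_smul (c : ℝ) (P : Env) : mult Scan (c • P) = fun x => c * mult Scan P x := by
  funext x
  simp only [mult, map_smul]
  change _ * (c • (leftOp P (expI Scan)).1 x) = _
  rw [Complex.real_smul]
  ring

theorem mult_sub (P Q : Env) : mult Scan (P - Q) = fun x => mult Scan P x - mult Scan Q x := by
  have : P - Q = P + (-1 : ℝ) • Q := by simp [sub_eq_add_neg]
  rw [this, mult_add, mult_smul]
  funext x
  push_cast
  ring

/-- Conjugation by `e^{iS}` turns the left-invariant field `X̃` into `X̃ + i X̃(S)`. -/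
theorem mult_ι_mul {X : AffSqAlg} {P : Env} {F F' : AffSq → ℂ} (hP : mult Scan P = F)
    (hF : HasFieldDeriv X F F') :
    mult Scan (UniversalEnvelopingAlgebra.ι ℝ X * P) =
      fun x => F' x + Complex.I * phaseDeriv X x * F x := by
  have hexp : HasFieldDeriv X (expI Scan).1
      (fun x => Complex.I * phaseDeriv X x * (expI Scan).1 x) := by
    refine ⟨(expI Scan).2, fun x => ?_⟩
    have h := ((hasFieldDeriv_Scan X).const_mul Complex.I)
    have h1 := ((h.differentiable x).hasFDerivAt.cexp).fderiv
    change fderiv ℝ (fun x => Complex.exp (Complex.I * (Scan.1 x : ℂ))) x (field X x) = _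
    rw [h1]
    rw [smul_apply, h.fderiv_field, smul_eq_mul]
    simp only [expI]
    ring
  have hinv : ∀ x, Complex.exp (-(Complex.I * (Scan.1 x : ℂ))) * (expI Scan).1 x = 1 := by
    intro x
    change _ * Complex.exp _ = 1
    rw [← Complex.exp_add]
    simp
  have hPF : (leftOp P (expI Scan)).1 = fun x => (expI Scan).1 x * F x := by
    funext x
    rw [← hP, mult, ← mul_assoc, mul_comm ((expI Scan).1 x), hinv, one_mul]
  funext x
  rw [mult, map_mul]
  change _ * (leftOp _ (leftOp P (expI Scan))).1 x = _
  rw [leftOp_ι, hPF, (hexp.mul hF).fderiv_field]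
  linear_combination (F' x + Complex.I * phaseDeriv X x * F x) * hinv x

/-- Conjugation of the square of a left-invariant field. -/
theorem mult_ι_mul_ι_mul {X : AffSqAlg} {P : Env} {F F' F'' s : AffSq → ℂ} (hP : mult Scan P = F)
    (hF : HasFieldDeriv X F F') (hF' : HasFieldDeriv X F' F'')
    (hs : HasFieldDeriv X (phaseDeriv X) s) :
    mult Scan (UniversalEnvelopingAlgebra.ι ℝ X * (UniversalEnvelopingAlgebra.ι ℝ X * P)) =
      fun x => F'' x + 2 * Complex.I * phaseDeriv X x * F' x +
        (Complex.I * s x - phaseDeriv X x ^ 2) * F x := by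
  rw [mult_ι_mul (mult_ι_mul hP hF) (hF'.add ((hs.const_mul Complex.I).mul hF))]
  funext x
  linear_combination phaseDeriv X x ^ 2 * F x * Complex.I_sq

theorem contDiff_mult (P : Env) : ContDiff ℝ ∞ (mult Scan P) := by
  have h : ContDiff ℝ ∞ fun x => Complex.exp (-(Complex.I * (Scan.1 x : ℂ))) :=
    (contDiff_const.mul (Complex.ofRealCLM.contDiff.comp Scan.2)).neg.cexp
  exact h.mul (contDiff_coe (leftOp P (expI Scan)))

/-! ### The multiplier of the adapted operator -/

/-- The function `D = 1 + sinh² (2a₁) + sinh² (2a₂)` on the group, complex-valued. -/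
noncomputable def dExp (x : AffSq) : ℂ :=
  1 + ((exp₁ 1 x - exp₁ (-1) x) / 2) ^ 2 + ((exp₂ 1 x - exp₂ (-1) x) / 2) ^ 2

theorem dExp_eq (x : AffSq) : dExp x = (dFun (x.1.1, x.2.1) : ℂ) := by
  rw [dExp, dFun, ← ofReal_sinh₁, ← ofReal_sinh₂]
  push_cast
  ring

/-- The element `(H₁ + H₂) / 2` of the Lie algebra. -/
noncomputable def sumH : AffSqAlg := (((1 / 2 : ℝ), (0 : ℝ)), ((1 / 2 : ℝ), (0 : ℝ)))

/-- The element `(H₁ - H₂) / 2` of the Lie algebra. -/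
noncomputable def diffH : AffSqAlg := (((1 / 2 : ℝ), (0 : ℝ)), ((-1 / 2 : ℝ), (0 : ℝ)))

/-- The element `A (A + 2) (A + 4) (A + 6)` of the enveloping algebra, where `A = (H₁ + H₂) / 2`. -/
noncomputable def rOp : Env :=
  let A : Env := UniversalEnvelopingAlgebra.ι ℝ sumH
  (A + (6 : ℝ) • 1) * ((A + (4 : ℝ) • 1) * ((A + (2 : ℝ) • 1) * (A * 1)))

/-- The element `1 - E₁² - E₂²` of the enveloping algebra. -/
noncomputable def dOp : Env := 1 - inl AffAlg.E ^ 2 - inr AffAlg.E ^ 2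

/-- The operator `A (A + 2) (A + 4) (A + 6) - B² + (1 - E₁² - E₂²)⁴`, where `A = (H₁ + H₂) / 2`
and `B = (H₁ - H₂) / 2`. -/
noncomputable def adaptedOp : Env :=
  rOp - UniversalEnvelopingAlgebra.ι ℝ diffH * (UniversalEnvelopingAlgebra.ι ℝ diffH * 1) +
    dOp ^ 4

theorem phaseDeriv_sumH (x : AffSq) : phaseDeriv sumH x = rFun x := by
  simp only [phaseDeriv, sumH]
  push_cast
  ring

theorem phaseDeriv_diffH (x : AffSq) : phaseDeriv diffH x = pFun x := by
  simp only [phaseDeriv, diffH]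
  push_cast
  ring

theorem hasFieldDeriv_sumH_rFun :
    HasFieldDeriv sumH (fun x => (rFun x : ℂ)) (fun x => -2 * rFun x) :=
  (hasFieldDeriv_rFun sumH).congr rfl (by funext x; simp only [sumH]; push_cast; ring)

theorem mult_sumH_add {c : ℝ} {P : Env} {F F' : AffSq → ℂ} (hP : mult Scan P = F)
    (hF : HasFieldDeriv sumH F F') :
    mult Scan ((UniversalEnvelopingAlgebra.ι ℝ sumH + c • (1 : Env)) * P) =
      fun x => F' x + Complex.I * rFun x * F x + c * F x := by
  rw [add_mul, mult_add, mult_ι_mul hP hF, smul_mul_assoc, one_mul, mult_smul, hP]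
  funext x
  simp only [phaseDeriv_sumH]

/-- The shifts `2, 4, 6` cancel the corrections coming from `A r = -2 r`. -/
theorem mult_rOp : mult Scan rOp = fun x => (rFun x : ℂ) ^ 4 := by
  have h1 : mult Scan (UniversalEnvelopingAlgebra.ι ℝ sumH * 1) = fun x => Complex.I * rFun x := by
    rw [mult_ι_mul mult_one (HasFieldDeriv.const sumH 1)]
    funext x
    rw [phaseDeriv_sumH]
    ring
  have hr := hasFieldDeriv_sumH_rFun
  have h2 := (mult_sumH_add (c := 2) h1 (hr.const_mul _)).trans
    (show _ = fun x => (-1 : ℂ) * (rFun x : ℂ) ^ 2 by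
      funext x
      push_cast
      linear_combination (rFun x : ℂ) ^ 2 * Complex.I_sq)
  have h3 := (mult_sumH_add (c := 4) h2 (hr.sq.const_mul _)).trans
    (show _ = fun x => (-Complex.I) * ((rFun x : ℂ) ^ 2 * rFun x) by
      funext x
      push_cast
      ring)
  have h4 := (mult_sumH_add (c := 6) h3 ((hr.sq.mul hr).const_mul _)).trans
    (show _ = fun x => (rFun x : ℂ) ^ 4 by
      funext x
      push_cast
      linear_combination -(rFun x : ℂ) ^ 4 * Complex.I_sq)
  exact h4

theorem mult_diffH_sq :
    mult Scan (UniversalEnvelopingAlgebra.ι ℝ diffH * (UniversalEnvelopingAlgebra.ι ℝ diffH * 1)) =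
      fun x => 2 * Complex.I * qFun x - (pFun x : ℂ) ^ 2 := by
  rw [mult_ι_mul_ι_mul mult_one (HasFieldDeriv.const diffH 1) (HasFieldDeriv.const diffH 0)
    (s := fun x => 2 * (qFun x : ℂ))
    ((hasFieldDeriv_pFun diffH).congr (funext phaseDeriv_diffH)
      (by funext x; simp only [diffH]; push_cast; ring))]
  funext x
  rw [phaseDeriv_diffH]
  ring

theorem _root_.AffAlg.zero_fst : (0 : AffAlg).1 = (0 : ℝ) := rfl

theorem _root_.AffAlg.zero_snd : (0 : AffAlg).2 = (0 : ℝ) := rfl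

/-- The functions `e^{±2a_j}` are constant along the fields of `E₁` and `E₂`. -/
theorem HasFieldDeriv.dExp_pow {X : AffSqAlg} (h₁ : X.1.1 = 0) (h₂ : X.2.1 = 0) (k : ℕ) :
    HasFieldDeriv X (fun x => dExp x ^ k) (fun _ => 0) := by
  have e₁ : ∀ c, HasFieldDeriv X (exp₁ c) (fun _ => 0) := fun c =>
    (hasFieldDeriv_exp₁ X c).congr rfl (by funext x; simp [h₁])
  have e₂ : ∀ c, HasFieldDeriv X (exp₂ c) (fun _ => 0) := fun c =>
    (hasFieldDeriv_exp₂ X c).congr rfl (by funext x; simp [h₂])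
  have hd : HasFieldDeriv X dExp (fun _ => 0) :=
    (((HasFieldDeriv.const X 1).add (((e₁ 1).sub (e₁ (-1))).const_mul (1 / 2)).sq).add
      (((e₂ 1).sub (e₂ (-1))).const_mul (1 / 2)).sq).congr
      (by funext x; simp only [dExp]; ring) (by funext x; ring)
  induction k with
  | zero => simpa using HasFieldDeriv.const X 1
  | succ k ih =>
    exact (ih.mul hd).congr (by funext x; rw [pow_succ]) (by funext x; ring)

theorem mult_dOp_pow (k : ℕ) : mult Scan (dOp ^ k) = fun x => dExp x ^ k := by
  induction k with
  | zero => simpa using mult_one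
  | succ k ih =>
    have h₁ : HasFieldDeriv ((AffAlg.E, 0) : AffSqAlg) (phaseDeriv (AffAlg.E, 0)) (fun _ => 0) :=
      (((hasFieldDeriv_exp₂ (AffAlg.E, 0) 1).sub
        (hasFieldDeriv_exp₂ (AffAlg.E, 0) (-1))).const_mul (-1 / 2)).congr
        (by
          funext x
          simp [phaseDeriv, AffAlg.E, AffAlg.zero_fst, AffAlg.zero_snd]
          ring)
        (by funext x; simp [AffAlg.zero_fst])
    have h₂ : HasFieldDeriv ((0, AffAlg.E) : AffSqAlg) (phaseDeriv (0, AffAlg.E)) (fun _ => 0) :=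
      (((hasFieldDeriv_exp₁ (0, AffAlg.E) 1).sub
        (hasFieldDeriv_exp₁ (0, AffAlg.E) (-1))).const_mul (1 / 2)).congr
        (by
          funext x
          simp [phaseDeriv, AffAlg.E, AffAlg.zero_fst, AffAlg.zero_snd]
          ring)
        (by funext x; simp [AffAlg.zero_fst])
    have d₁ := HasFieldDeriv.dExp_pow (X := ((AffAlg.E, 0) : AffSqAlg)) rfl rfl k
    have d₂ := HasFieldDeriv.dExp_pow (X := ((0, AffAlg.E) : AffSqAlg)) rfl rfl k
    have m₁ := mult_ι_mul_ι_mul ih d₁ (HasFieldDeriv.const _ 0) h₁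
    have m₂ := mult_ι_mul_ι_mul ih d₂ (HasFieldDeriv.const _ 0) h₂
    have : dOp ^ (k + 1) = dOp ^ k - inl AffAlg.E * (inl AffAlg.E * dOp ^ k) -
        inr AffAlg.E * (inr AffAlg.E * dOp ^ k) := by
      rw [pow_succ', dOp]
      noncomm_ring
    rw [this, mult_sub, mult_sub, ih]
    simp only [inl, inr]
    rw [m₁, m₂]
    funext x
    simp [phaseDeriv, AffAlg.E, AffAlg.zero_fst, AffAlg.zero_snd, dExp]
    ring

theorem mult_adaptedOp : mult Scan adaptedOp = fun x =>
    (rFun x : ℂ) ^ 4 + (pFun x : ℂ) ^ 2 - 2 * Complex.I * qFun x + dExp x ^ 4 := by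
  rw [adaptedOp, mult_add, mult_sub, mult_rOp, mult_diffH_sq, mult_dOp_pow]
  funext x
  ring

/-! ### Bounds between the basic functions -/

theorem exp_sq_le_sinh (a : ℝ) : Real.exp a ^ 2 ≤ 4 * Real.sinh a ^ 2 + 2 := by
  have h : Real.exp a * Real.exp (-a) = 1 := by rw [← Real.exp_add]; simp
  rw [Real.sinh_eq]
  nlinarith [sq_nonneg (Real.exp (-a))]

theorem one_le_dFun (a : ℝ × ℝ) : 1 ≤ dFun a := by
  unfold dFun
  nlinarith [sq_nonneg (Real.sinh (2 * a.1)), sq_nonneg (Real.sinh (2 * a.2))]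

/-- The identity `q cosh (2 (a₁ - a₂)) = p sinh (2 (a₁ - a₂)) + r e^{2 (a₁ + a₂)}` bounds `q`, and
`e^{2 (a₁ + a₂)} ≤ 2 D`. -/
theorem qFun_sq_le (x : AffSq) :
    qFun x ^ 2 ≤ 2 * pFun x ^ 2 + 8 * rFun x ^ 2 * dFun (x.1.1, x.2.1) ^ 2 := by
  have h1 := exp_sq_le_sinh (2 * x.1.1)
  have h2 := exp_sq_le_sinh (2 * x.2.1)
  have hD : dFun (x.1.1, x.2.1) = 1 + Real.sinh (2 * x.1.1) ^ 2 + Real.sinh (2 * x.2.1) ^ 2 := rfl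
  have i1 : Real.exp (2 * x.1.1) * Real.exp (-(2 * x.1.1)) = 1 := by rw [← Real.exp_add]; simp
  have i2 : Real.exp (2 * x.2.1) * Real.exp (-(2 * x.2.1)) = 1 := by rw [← Real.exp_add]; simp
  have p1 := Real.exp_pos (2 * x.1.1)
  have p2 := Real.exp_pos (2 * x.2.1)
  have n1 := Real.exp_pos (-(2 * x.1.1))
  have n2 := Real.exp_pos (-(2 * x.2.1))
  simp only [pFun, qFun, rFun]
  generalize dFun (x.1.1, x.2.1) = D at *
  generalize Real.exp (2 * x.1.1) = e₁ at *
  generalize Real.exp (2 * x.2.1) = e₂ at *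
  generalize Real.exp (-(2 * x.1.1)) = f₁ at *
  generalize Real.exp (-(2 * x.2.1)) = f₂ at *
  generalize x.1.2 = l₁
  generalize x.2.2 = l₂
  set p := e₁ * l₂ + e₂ * l₁ with hp
  set q := e₁ * l₂ - e₂ * l₁ with hq
  set r := f₁ * l₂ - f₂ * l₁ with hr
  set K := (e₁ * f₂ + e₂ * f₁) / 2 with hK
  set T := (e₁ * f₂ - e₂ * f₁) / 2 with hT
  have hKT : K ^ 2 = T ^ 2 + 1 := by
    rw [hK, hT]
    linear_combination e₂ * f₂ * i1 + i2
  have key : q * K = p * T + r * (e₁ * e₂) := by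
    rw [hp, hq, hr, hK, hT]
    ring
  have he : e₁ * e₂ ≤ 2 * D := by nlinarith [sq_nonneg (e₁ - e₂)]
  have he' : (e₁ * e₂) ^ 2 ≤ (2 * D) ^ 2 := pow_le_pow_left₀ (by positivity) he 2
  have hq2 : q ^ 2 * K ^ 2 ≤ (2 * p ^ 2 + 2 * r ^ 2 * (e₁ * e₂) ^ 2) * K ^ 2 := by
    have : (q * K) ^ 2 ≤ 2 * (p * T) ^ 2 + 2 * (r * (e₁ * e₂)) ^ 2 := by
      rw [key]
      nlinarith [sq_nonneg (p * T - r * (e₁ * e₂))]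
    have h0 : 0 ≤ 2 * r ^ 2 * (e₁ * e₂) ^ 2 * T ^ 2 := by positivity
    nlinarith [sq_nonneg p]
  have hK0 : 0 < K ^ 2 := by nlinarith [sq_nonneg T]
  have := le_of_mul_le_mul_right hq2 hK0
  nlinarith [mul_le_mul_of_nonneg_left he' (sq_nonneg r)]

/-! ### A weight -/

/-- The function `p² + r⁴ + D⁴`, the real part of the multiplier of `adaptedOp`. -/
noncomputable def weightFun (x : AffSq) : ℝ :=
  pFun x ^ 2 + rFun x ^ 4 + dFun (x.1.1, x.2.1) ^ 4

/-- The filtration of the algebra generated by the functions `e^{2 c a_j}` with `|c| ≤ 1`, of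
degree `1`, `r`, of degree `2`, and `p` and `q`, of degree `4`: `IsSymbol d F` says that `F` is a
polynomial of degree at most `d` in these functions. Left-invariant derivatives do not increase
the degree, and a function of degree `d` is bounded by a multiple of the power `d / 8` of
`p² + r⁴ + D⁴`. -/
inductive IsSymbol : ℕ → (AffSq → ℂ) → Prop
  | const (c : ℂ) : IsSymbol 0 (fun _ => c)
  | exp₁ (c : ℝ) (hc : |c| ≤ 1) : IsSymbol 1 (exp₁ c)
  | exp₂ (c : ℝ) (hc : |c| ≤ 1) : IsSymbol 1 (exp₂ c)
  | rFun : IsSymbol 2 (fun x => (rFun x : ℂ))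
  | pFun : IsSymbol 4 (fun x => (pFun x : ℂ))
  | qFun : IsSymbol 4 (fun x => (qFun x : ℂ))
  | add {d : ℕ} {F G : AffSq → ℂ} : IsSymbol d F → IsSymbol d G → IsSymbol d (fun x => F x + G x)
  | mul {d e : ℕ} {F G : AffSq → ℂ} :
      IsSymbol d F → IsSymbol e G → IsSymbol (d + e) (fun x => F x * G x)
  | mono {d e : ℕ} {F : AffSq → ℂ} : d ≤ e → IsSymbol d F → IsSymbol e F

namespace IsSymbol

variable {d : ℕ} {F G : AffSq → ℂ}

theorem const_mul (c : ℂ) (hF : IsSymbol d F) : IsSymbol d (fun x => c * F x) :=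
  ((IsSymbol.const c).mul hF).mono (by simp)

theorem sub (hF : IsSymbol d F) (hG : IsSymbol d G) : IsSymbol d (fun x => F x - G x) := by
  convert hF.add (hG.const_mul (-1)) using 2
  ring

theorem pow (hF : IsSymbol d F) (k : ℕ) : IsSymbol (k * d) (fun x => F x ^ k) := by
  induction k with
  | zero => simpa using IsSymbol.const 1
  | succ k ih =>
    convert ih.mul hF using 1
    · ring
    · simp only [pow_succ]

theorem dExp : IsSymbol 2 dExp := by
  have e₁ := (IsSymbol.exp₁ 1 (by simp)).sub (IsSymbol.exp₁ (-1) (by simp))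
  have e₂ := (IsSymbol.exp₂ 1 (by simp)).sub (IsSymbol.exp₂ (-1) (by simp))
  convert (((IsSymbol.const 1).mono (Nat.zero_le 2)).add ((e₁.const_mul (1 / 2)).pow 2)).add
    ((e₂.const_mul (1 / 2)).pow 2) using 2
  simp only [AffSq.dExp]
  ring

/-- The filtration is stable under left-invariant vector fields. -/
theorem exists_hasFieldDeriv (X : AffSqAlg) (hF : IsSymbol d F) :
    ∃ F', IsSymbol d F' ∧ HasFieldDeriv X F F' := by
  induction hF with
  | const c => exact ⟨_, .const 0, .const X c⟩
  | exp₁ c hc => exact ⟨_, (IsSymbol.exp₁ c hc).const_mul _, hasFieldDeriv_exp₁ X c⟩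
  | exp₂ c hc => exact ⟨_, (IsSymbol.exp₂ c hc).const_mul _, hasFieldDeriv_exp₂ X c⟩
  | rFun =>
    exact ⟨_, ((IsSymbol.rFun.const_mul _).sub
      (((IsSymbol.exp₂ (-1) (by simp)).const_mul _).mono one_le_two)).add
      (((IsSymbol.exp₁ (-1) (by simp)).const_mul _).mono one_le_two), hasFieldDeriv_rFun X⟩
  | pFun =>
    exact ⟨_, ((IsSymbol.qFun.const_mul _).add
      (((IsSymbol.exp₂ 1 (by simp)).const_mul _).mono (by norm_num))).add
      (((IsSymbol.exp₁ 1 (by simp)).const_mul _).mono (by norm_num)), hasFieldDeriv_pFun X⟩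
  | qFun =>
    exact ⟨_, ((IsSymbol.pFun.const_mul _).sub
      (((IsSymbol.exp₂ 1 (by simp)).const_mul _).mono (by norm_num))).add
      (((IsSymbol.exp₁ 1 (by simp)).const_mul _).mono (by norm_num)), hasFieldDeriv_qFun X⟩
  | add _ _ ihF ihG =>
    obtain ⟨F', hF', hF⟩ := ihF
    obtain ⟨G', hG', hG⟩ := ihG
    exact ⟨_, hF'.add hG', hF.add hG⟩
  | mul sF sG ihF ihG =>
    obtain ⟨F', hF', hF⟩ := ihF
    obtain ⟨G', hG', hG⟩ := ihG
    exact ⟨_, (hF'.mul sG).add (sF.mul hG'), hF.mul hG⟩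
  | mono h _ ih =>
    obtain ⟨F', hF', hF⟩ := ih
    exact ⟨F', hF'.mono h, hF⟩

end IsSymbol

theorem norm_exp_le {a b c t : ℝ} (hc : |c| ≤ 1) (ht : 0 ≤ t)
    (h : 1 + Real.sinh (2 * a) ^ 2 + b ^ 2 ≤ t ^ 2) :
    ‖((Real.exp (2 * c * a) : ℝ) : ℂ)‖ ≤ 2 * t := by
  rw [Complex.norm_real, Real.norm_of_nonneg (Real.exp_pos _).le]
  have h1 : 2 * c * a ≤ |2 * a| := by
    refine (le_abs_self _).trans ?_
    rw [show 2 * c * a = c * (2 * a) by ring, abs_mul]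
    exact mul_le_of_le_one_left (abs_nonneg _) hc
  have h2 : Real.exp |2 * a| ≤ 2 * Real.cosh (2 * a) := by
    rw [← Real.cosh_abs, Real.cosh_eq]
    linarith [Real.exp_pos (-|2 * a|)]
  have h3 : Real.cosh (2 * a) ≤ t := by
    refine abs_le_of_sq_le_sq' ?_ ht |>.2
    rw [Real.cosh_sq]
    nlinarith [sq_nonneg b]
  linarith [Real.exp_le_exp.2 h1]

theorem one_le_weightFun (x : AffSq) : 1 ≤ weightFun x := by
  have h := one_le_pow₀ (n := 4) (one_le_dFun (x.1.1, x.2.1))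
  unfold weightFun
  nlinarith [sq_nonneg (pFun x), sq_nonneg (rFun x ^ 2)]

theorem sqrt_weightFun_pow_eight (x : AffSq) : √√√(weightFun x) ^ 8 = weightFun x := by
  rw [show 8 = 2 * 2 * 2 from rfl, pow_mul, pow_mul, Real.sq_sqrt (by positivity),
    Real.sq_sqrt (by positivity), Real.sq_sqrt (zero_le_one.trans (one_le_weightFun x))]

/-- A function of degree `d` is bounded by the power `d` of `(p² + r⁴ + D⁴)^{1/8}`. -/
theorem IsSymbol.norm_le {d : ℕ} {F : AffSq → ℂ} (hF : IsSymbol d F) :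
    ∃ C : ℝ, 0 ≤ C ∧ ∀ x, ‖F x‖ ≤ C * √√√(weightFun x) ^ d := by
  have hone : ∀ x, 1 ≤ √√√(weightFun x) := fun x => by
    simpa using one_le_weightFun x
  have hpow := sqrt_weightFun_pow_eight
  have hD : ∀ x : AffSq, dFun (x.1.1, x.2.1) ≤ √√√(weightFun x) ^ 2 := fun x => by
    refine le_of_pow_le_pow_left₀ (n := 4) (by norm_num) (by positivity) ?_
    rw [← pow_mul, hpow, weightFun]
    nlinarith [sq_nonneg (AffSq.pFun x), sq_nonneg (AffSq.rFun x ^ 2)]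
  have hp : ∀ x, |AffSq.pFun x| ≤ √√√(weightFun x) ^ 4 := fun x => by
    refine abs_le_of_sq_le_sq ?_ (by positivity)
    rw [← pow_mul, hpow, weightFun]
    nlinarith [sq_nonneg (dFun (x.1.1, x.2.1) ^ 2), sq_nonneg (AffSq.rFun x ^ 2)]
  induction hF with
  | const c => exact ⟨‖c‖, norm_nonneg c, fun x => by simp⟩
  | exp₁ c hc =>
    refine ⟨2, by norm_num, fun x => ?_⟩
    rw [pow_one]
    exact norm_exp_le hc (by positivity) (hD x)
  | exp₂ c hc =>
    refine ⟨2, by norm_num, fun x => ?_⟩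
    rw [pow_one]
    refine norm_exp_le (b := Real.sinh (2 * x.1.1)) hc (by positivity)
      (le_trans (le_of_eq ?_) (hD x))
    rw [dFun]
    ring
  | rFun =>
    refine ⟨1, by norm_num, fun x => ?_⟩
    rw [Complex.norm_real, Real.norm_eq_abs, one_mul]
    refine le_of_pow_le_pow_left₀ (n := 4) (by norm_num) (by positivity) ?_
    rw [← pow_mul, hpow, weightFun, Even.pow_abs (by decide)]
    nlinarith [sq_nonneg (dFun (x.1.1, x.2.1) ^ 2), sq_nonneg (AffSq.pFun x)]
  | pFun =>
    refine ⟨1, by norm_num, fun x => ?_⟩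
    rw [Complex.norm_real, Real.norm_eq_abs, one_mul]
    exact hp x
  | qFun =>
    refine ⟨4, by norm_num, fun x => ?_⟩
    rw [Complex.norm_real, Real.norm_eq_abs]
    refine abs_le_of_sq_le_sq ?_ (by positivity)
    rw [mul_pow, ← pow_mul, hpow, weightFun]
    -- `8 r² D² ≤ r⁴ + 16 D⁴`
    nlinarith [qFun_sq_le x, sq_nonneg (AffSq.rFun x ^ 2 - 4 * dFun (x.1.1, x.2.1) ^ 2),
      sq_nonneg (AffSq.pFun x), sq_nonneg (AffSq.rFun x ^ 2)]
  | add _ _ ihF ihG =>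
    obtain ⟨C, hC, hF⟩ := ihF
    obtain ⟨C', hC', hG⟩ := ihG
    refine ⟨C + C', by positivity, fun x => (norm_add_le _ _).trans ?_⟩
    rw [add_mul]
    exact add_le_add (hF x) (hG x)
  | mul _ _ ihF ihG =>
    obtain ⟨C, hC, hF⟩ := ihF
    obtain ⟨C', hC', hG⟩ := ihG
    refine ⟨C * C', by positivity, fun x => ?_⟩
    rw [norm_mul, pow_add, mul_mul_mul_comm]
    exact mul_le_mul (hF x) (hG x) (norm_nonneg _) (by positivity)
  | mono h _ ih =>
    obtain ⟨C, hC, hF⟩ := ih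
    exact ⟨C, hC, fun x => (hF x).trans
      (mul_le_mul_of_nonneg_left (pow_le_pow_right₀ (hone x) h) hC)⟩

theorem leftOp_ι_eq (X : AffSqAlg) :
    leftOp (UniversalEnvelopingAlgebra.ι ℝ X) = leftDeriv X := by
  rw [leftOp, UniversalEnvelopingAlgebra.lift_ι_apply]
  rfl

/-- A space of smooth functions that is stable under left-invariant vector fields is stable under
all left-invariant differential operators. -/
theorem leftOp_mem {N : Smooth → Prop} (hadd : ∀ F G, N F → N G → N (F + G))
    (hsmul : ∀ (c : ℝ) F, N F → N (c • F)) (hN : ∀ X F, N F → N (leftDeriv X F)) (P : Env)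
    {F : Smooth} (hF : N F) : N (leftOp P F) := by
  obtain ⟨t, rfl⟩ : ∃ t, UniversalEnvelopingAlgebra.mkAlgHom ℝ AffSqAlg t = P :=
    (RingCon.mk'_surjective (c := UniversalEnvelopingAlgebra.ringCon ℝ AffSqAlg)) P
  induction t using TensorAlgebra.induction generalizing F with
  | algebraMap c =>
    rw [AlgHom.commutes, AlgHom.commutes]
    exact hsmul c F hF
  | ι X =>
    have := hN X F hF
    rw [← leftOp_ι_eq] at this
    exact this
  | mul s t hs ht =>
    rw [_root_.map_mul, _root_.map_mul]
    exact hs (ht hF)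
  | add s t hs ht =>
    rw [map_add, map_add]
    exact hadd _ _ (hs hF) (ht hF)

/-- Functions of degree at most `8` lie in the symbol space of any function that dominates
`p² + r⁴ + D⁴`. -/
theorem IsSymbol.mem_symbolSpace {m : AffSq → ℂ} (hm : ∀ x, weightFun x ≤ ‖m x‖) {F : Smooth}
    (hF : IsSymbol 8 F.1) : F ∈ symbolSpace m := by
  intro P
  have h8 : IsSymbol 8 (leftOp P F).1 := by
    refine leftOp_mem (N := fun F => IsSymbol 8 F.1) (fun F G hF hG => hF.add hG)
      (fun c F hF => ?_) (fun X F hF => ?_) P hF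
    · convert hF.const_mul (c : ℂ) using 1
      funext x
      exact Complex.real_smul
    · obtain ⟨F', hF', h⟩ := hF.exists_hasFieldDeriv X
      convert hF' using 1
      funext x
      rw [leftDeriv_apply, h.fderiv_field]
  obtain ⟨C, hC, h⟩ := h8.norm_le
  refine ⟨C + 1, by positivity, fun x => ?_⟩
  have h1 := one_le_weightFun x
  have h2 := h x
  rw [sqrt_weightFun_pow_eight] at h2
  nlinarith [mul_le_mul_of_nonneg_left (hm x) hC, hm x]

/-- The real part of the multiplier of `adaptedOp` is `p² + r⁴ + D⁴`. -/
theorem weightFun_le_norm_mult (x : AffSq) : weightFun x ≤ ‖mult Scan adaptedOp x‖ := by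
  have h : mult Scan adaptedOp x = (weightFun x : ℂ) + ((-2 * qFun x : ℝ) : ℂ) * Complex.I := by
    rw [mult_adaptedOp, weightFun]
    simp only [dExp_eq]
    push_cast
    ring
  refine le_trans (le_of_eq ?_) (Complex.re_le_norm _)
  rw [h]
  simp

theorem isSymbol_mult_adaptedOp : IsSymbol 8 (mult Scan adaptedOp) := by
  rw [mult_adaptedOp]
  exact (((IsSymbol.rFun.pow 4).add (IsSymbol.pFun.pow 2)).sub
    ((IsSymbol.qFun.const_mul _).mono (by norm_num))).add (IsSymbol.dExp.pow 4)

theorem isWeight_mult_adaptedOp : IsWeight (mult Scan adaptedOp) := by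
  refine ⟨fun x hx => ?_, contDiff_mult _,
    IsSymbol.mem_symbolSpace weightFun_le_norm_mult isSymbol_mult_adaptedOp⟩
  have h := weightFun_le_norm_mult x
  rw [hx, norm_zero] at h
  linarith [one_le_weightFun x]

/-! ### Integration over the fibres -/

theorem lintegral_inv_mul_add_sq {α β : ℝ} (hα : 0 < α) (hβ : 0 < β) :
    ∫⁻ t : ℝ, ENNReal.ofReal (1 / (α * (β ^ 2 + t ^ 2))) =
      ENNReal.ofReal (Real.pi / (α * β)) := by
  have h : ∀ t : ℝ, 1 / (α * (β ^ 2 + t ^ 2)) =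
      (1 / (α * β ^ 2)) * (1 + (t / β) ^ 2)⁻¹ := fun t => by
    have : 0 < β ^ 2 + t ^ 2 := by positivity
    field_simp
  have hi : Integrable fun t : ℝ => (1 / (α * β ^ 2)) * (1 + (t / β) ^ 2)⁻¹ :=
    (integrable_inv_one_add_sq.comp_div hβ.ne').const_mul _
  simp_rw [h]
  rw [← ofReal_integral_eq_lintegral_ofReal hi
      (Filter.Eventually.of_forall fun t => by positivity),
    integral_const_mul, Measure.integral_comp_div (fun t : ℝ => (1 + t ^ 2)⁻¹),
    integral_univ_inv_one_add_sq, abs_of_pos hβ, smul_eq_mul]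
  congr 1
  field_simp

/-- Integration first in `p`, then in `r`. -/
theorem lintegral_fibre_le {α β : ℝ → ℝ} (hα : Continuous α) (hβ : Continuous β)
    (hα0 : ∀ r, 0 < α r) (hβ0 : ∀ r, 0 < β r) {γ δ : ℝ} (hγ : 0 < γ) (hδ : 0 < δ)
    (h : ∀ r, γ * (δ ^ 2 + r ^ 2) ≤ 2 * (α r * β r)) :
    ∫⁻ z : ℝ × ℝ, ENNReal.ofReal (1 / (α z.2 * (β z.2 ^ 2 + z.1 ^ 2))) ≤
      ENNReal.ofReal (2 * Real.pi ^ 2 / (γ * δ)) := by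
  rw [Measure.volume_eq_prod, lintegral_prod_symm _ (by fun_prop)]
  calc ∫⁻ r, ∫⁻ p, ENNReal.ofReal (1 / (α r * (β r ^ 2 + p ^ 2)))
      = ∫⁻ r, ENNReal.ofReal (Real.pi / (α r * β r)) :=
        lintegral_congr fun r => lintegral_inv_mul_add_sq (hα0 r) (hβ0 r)
    _ ≤ ∫⁻ r, ENNReal.ofReal (1 / (γ / (2 * Real.pi) * (δ ^ 2 + r ^ 2))) := by
        refine lintegral_mono fun r => ENNReal.ofReal_le_ofReal ?_
        have h0 : 0 < α r * β r := mul_pos (hα0 r) (hβ0 r)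
        have h1 : 0 < δ ^ 2 + r ^ 2 := by positivity
        have hpi := Real.pi_pos
        rw [div_le_div_iff₀ h0 (by positivity), one_mul]
        have := h r
        field_simp
        linarith
    _ = ENNReal.ofReal (2 * Real.pi ^ 2 / (γ * δ)) := by
        rw [lintegral_inv_mul_add_sq (by positivity) hδ]
        congr 1
        field_simp

/-- For fixed `(a₁, a₂)`, the linear change of variables `(ℓ₁, ℓ₂) ↦ (p, r)` has determinant
`2 cosh (2 (a₁ - a₂))`. -/
theorem lintegral_comp_pFun_rFun (a : ℝ × ℝ) {g : ℝ × ℝ → ENNReal} (hg : Measurable g) :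
    ∫⁻ l : ℝ × ℝ, g (pFun ((a.1, l.1), (a.2, l.2)), rFun ((a.1, l.1), (a.2, l.2))) =
      ENNReal.ofReal (1 / (2 * Real.cosh (2 * (a.1 - a.2)))) * ∫⁻ z, g z := by
  let b := Module.Basis.finTwoProd ℝ
  let A : Matrix (Fin 2) (Fin 2) ℝ :=
    !![Real.exp (2 * a.2), Real.exp (2 * a.1); -Real.exp (-(2 * a.2)), Real.exp (-(2 * a.1))]
  let f : ℝ × ℝ →ₗ[ℝ] ℝ × ℝ := Matrix.toLin b b A
  have hf : ∀ l : ℝ × ℝ,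
      (pFun ((a.1, l.1), (a.2, l.2)), rFun ((a.1, l.1), (a.2, l.2))) = f l := by
    intro l
    simp only [f, A, b, Matrix.toLin_finTwoProd_apply, pFun, rFun]
    ext <;> simp <;> ring
  have hdet : LinearMap.det f = 2 * Real.cosh (2 * (a.1 - a.2)) := by
    simp only [f, A, LinearMap.det_toLin, Matrix.det_fin_two_of, Real.cosh_eq, mul_neg,
      sub_neg_eq_add, ← Real.exp_add]
    ring_nf
  have hpos : 0 < 2 * Real.cosh (2 * (a.1 - a.2)) := by positivity
  have hne : LinearMap.det f ≠ 0 := by rw [hdet]; exact hpos.ne'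
  have hfm : Measurable f := f.continuous_of_finiteDimensional.measurable
  simp only [hf]
  rw [← lintegral_map hg hfm, Measure.map_linearMap_addHaar_eq_smul_addHaar _ hne,
    lintegral_smul_measure, hdet, abs_of_pos (inv_pos.2 hpos), one_div, smul_eq_mul]

theorem lintegral_affSq {g : AffSq → ENNReal} (hg : Measurable g) :
    ∫⁻ x, g x = ∫⁻ a : ℝ × ℝ, ∫⁻ l : ℝ × ℝ, g ((a.1, l.1), (a.2, l.2)) := by
  -- the order of integration is `a₁, ℓ₁, a₂, ℓ₂`, so the two inner variables are exchanged
  rw [Measure.volume_eq_prod, lintegral_prod _ hg.aemeasurable, Measure.volume_eq_prod,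
    lintegral_prod _ (by fun_prop), lintegral_prod _ (by fun_prop)]
  refine lintegral_congr fun a₁ => ?_
  calc ∫⁻ l₁, ∫⁻ y : ℝ × ℝ, g ((a₁, l₁), y) ∂(volume.prod volume)
      = ∫⁻ l₁, ∫⁻ a₂, ∫⁻ l₂, g ((a₁, l₁), (a₂, l₂)) :=
        lintegral_congr fun l₁ =>
          lintegral_prod (fun y : ℝ × ℝ => g ((a₁, l₁), y)) (by fun_prop)
    _ = ∫⁻ a₂, ∫⁻ l₁, ∫⁻ l₂, g ((a₁, l₁), (a₂, l₂)) := lintegral_lintegral_swap (by fun_prop)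
    _ = ∫⁻ a₂, ∫⁻ l : ℝ × ℝ, g ((a₁, l.1), (a₂, l.2)) ∂(volume.prod volume) :=
        lintegral_congr fun a₂ =>
          (lintegral_prod (fun l : ℝ × ℝ => g ((a₁, l.1), (a₂, l.2))) (by fun_prop)).symm

theorem dFun_eq_cosh_mul_cosh (a : ℝ × ℝ) :
    dFun a = Real.cosh (2 * (a.1 + a.2)) * Real.cosh (2 * (a.1 - a.2)) := by
  rw [dFun, mul_add, mul_sub, Real.cosh_add, Real.cosh_sub]
  linear_combination (-Real.cosh (2 * a.2) ^ 2) * Real.cosh_sq (2 * a.1) -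
    (1 + Real.sinh (2 * a.1) ^ 2) * Real.cosh_sq (2 * a.2)

/-- The square root in the integrability condition is at most twice `D cosh (2 (a₁ - a₂))`, the
inverse of the decay of the integrals over the fibres. -/
theorem sqrt_cosh_le (a : ℝ × ℝ) :
    √(Real.cosh (2 * (a.1 - a.2)) * Real.cosh (4 * (a.1 + a.2)) * Real.cosh (4 * (a.1 - a.2))) ≤
      2 * Real.cosh (2 * (a.1 - a.2)) * dFun a := by
  have hK := Real.one_le_cosh (2 * (a.1 - a.2))
  have h4 : ∀ t : ℝ, Real.cosh (4 * t) ≤ 2 * Real.cosh (2 * t) ^ 2 := fun t => by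
    rw [show 4 * t = 2 * (2 * t) by ring, Real.cosh_two_mul, Real.sinh_sq]
    linarith
  rw [Real.sqrt_le_left (by have := one_le_dFun a; positivity), dFun_eq_cosh_mul_cosh]
  calc _ ≤ Real.cosh (2 * (a.1 - a.2)) * (2 * Real.cosh (2 * (a.1 + a.2)) ^ 2) *
        (2 * Real.cosh (2 * (a.1 - a.2)) ^ 2) := by
        gcongr
        · exact h4 _
        · exact h4 _
    _ ≤ Real.cosh (2 * (a.1 - a.2)) ^ 2 * (2 * Real.cosh (2 * (a.1 + a.2)) ^ 2) *
        (2 * Real.cosh (2 * (a.1 - a.2)) ^ 2) := by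
        gcongr
        exact le_self_pow₀ hK two_ne_zero
    _ = _ := by ring

/-- If `M` dominates a function `α (β² + p²)` of `(p, r)` on each fibre, where `2 α β` dominates
`γ (δ² + r²)` with `γ δ = D`, then the integral of `1 / M` over the fibre is at most a constant
times `1 / (D cosh (2 (a₁ - a₂)))`, so that the quotients `w / M` are integrable. -/
theorem integrable_div {M : AffSq → ℂ} (hM : Continuous M) (hM0 : ∀ x, M x ≠ 0)
    {α β : ℝ × ℝ → ℝ → ℝ} {γ δ : ℝ × ℝ → ℝ}
    (hα : ∀ a, Continuous (α a)) (hβ : ∀ a, Continuous (β a))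
    (hα0 : ∀ a r, 0 < α a r) (hβ0 : ∀ a r, 0 < β a r) (hγ : ∀ a, 0 < γ a) (hδ : ∀ a, 0 < δ a)
    (hγδ : ∀ a, γ a * δ a = dFun a)
    (hαβ : ∀ a r, γ a * (δ a ^ 2 + r ^ 2) ≤ 2 * (α a r * β a r))
    (hle : ∀ x : AffSq, α (x.1.1, x.2.1) (rFun x) *
      (β (x.1.1, x.2.1) (rFun x) ^ 2 + pFun x ^ 2) ≤ ‖M x‖)
    {w : ℝ × ℝ → ℂ} (hw : Continuous w) (hwi : IntegrabilityCondition w) :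
    Integrable fun x : AffSq => w (x.1.1, x.2.1) / M x := by
  have hc : Continuous fun x : AffSq => w (x.1.1, x.2.1) / M x :=
    (hw.comp (by fun_prop)).div hM hM0
  refine ⟨hc.aestronglyMeasurable, ?_⟩
  rw [hasFiniteIntegral_iff_enorm, lintegral_affSq (by fun_prop)]
  refine lt_of_le_of_lt ?_ (ENNReal.mul_lt_top (ENNReal.ofReal_lt_top (r := 2 * Real.pi ^ 2))
    hwi.hasFiniteIntegral)
  rw [← lintegral_const_mul' _ _ ENNReal.ofReal_ne_top]
  refine lintegral_mono fun a => ?_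
  set K := Real.cosh (2 * (a.1 - a.2)) with hKdef
  have hK : 0 < K := Real.cosh_pos _
  have hD : 0 < dFun a := zero_lt_one.trans_le (one_le_dFun a)
  have hJ : ∀ z : ℝ × ℝ, 0 < α a z.2 * (β a z.2 ^ 2 + z.1 ^ 2) := fun z =>
    mul_pos (hα0 a _) (by have := hβ0 a z.2; positivity)
  have hmeas : Measurable fun z : ℝ × ℝ =>
      ENNReal.ofReal (1 / (α a z.2 * (β a z.2 ^ 2 + z.1 ^ 2))) := by
    have h1 := hα a
    have h2 := hβ a
    fun_prop
  calc ∫⁻ l : ℝ × ℝ, ‖w (a.1, a.2) / M ((a.1, l.1), (a.2, l.2))‖ₑ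
      ≤ ∫⁻ l : ℝ × ℝ, ENNReal.ofReal ‖w a‖ *
        (fun z : ℝ × ℝ => ENNReal.ofReal (1 / (α a z.2 * (β a z.2 ^ 2 + z.1 ^ 2))))
          (pFun ((a.1, l.1), (a.2, l.2)), rFun ((a.1, l.1), (a.2, l.2))) := by
        refine lintegral_mono fun l => ?_
        rw [← ENNReal.ofReal_mul (norm_nonneg _), ← ofReal_norm, norm_div]
        refine ENNReal.ofReal_le_ofReal ?_
        rw [div_eq_mul_one_div]
        refine mul_le_mul_of_nonneg_left ?_ (norm_nonneg _)
        exact one_div_le_one_div_of_le (hJ (_, _)) (hle ((a.1, l.1), (a.2, l.2)))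
    _ = ENNReal.ofReal ‖w a‖ * (ENNReal.ofReal (1 / (2 * K)) *
        ∫⁻ z : ℝ × ℝ, ENNReal.ofReal (1 / (α a z.2 * (β a z.2 ^ 2 + z.1 ^ 2)))) := by
        rw [lintegral_const_mul' _ _ ENNReal.ofReal_ne_top, lintegral_comp_pFun_rFun a hmeas]
    _ ≤ ENNReal.ofReal ‖w a‖ * (ENNReal.ofReal (1 / (2 * K)) *
        ENNReal.ofReal (2 * Real.pi ^ 2 / dFun a)) := by
        gcongr
        rw [← hγδ a]
        exact lintegral_fibre_le (hα a) (hβ a) (hα0 a) (hβ0 a) (hγ a) (hδ a) (hαβ a)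
    _ ≤ _ := by
        rw [← ENNReal.ofReal_mul (by positivity), ← ENNReal.ofReal_mul (norm_nonneg _),
          ← ofReal_norm, ← ENNReal.ofReal_mul (by positivity), norm_div, Complex.norm_real,
          Real.norm_of_nonneg (Real.sqrt_nonneg _)]
        refine ENNReal.ofReal_le_ofReal ?_
        have h := sqrt_cosh_le a
        rw [← hKdef] at h
        have h0 : 0 < √(K * Real.cosh (4 * (a.1 + a.2)) * Real.cosh (4 * (a.1 - a.2))) := by
          have := Real.cosh_pos (4 * (a.1 + a.2))
          have := Real.cosh_pos (4 * (a.1 - a.2))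
          positivity
        calc _ = 2 * Real.pi ^ 2 * (‖w a‖ / (2 * K * dFun a)) := by field_simp
          _ ≤ _ := by gcongr

/-- Restriction to the slice `ℓ₁ = ℓ₂ = 0` recovers `w` from the weight. -/
theorem continuous_of_isWeight {w : ℝ × ℝ → ℂ} (hw : IsWeight fun x => w (x.1.1, x.2.1)) :
    Continuous w := by
  obtain ⟨-, hm, -⟩ := hw
  exact hm.continuous.comp (g := fun x : AffSq => w (x.1.1, x.2.1))
    (f := fun a : ℝ × ℝ => (((a.1, 0), (a.2, 0)) : AffSq)) (by fun_prop)

/-- The constant function `1` satisfies the integrability condition: the product of hyperbolic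
cosines grows exponentially in every direction of the plane. -/
theorem integrabilityCondition_one : IntegrabilityCondition fun _ => 1 := by
  have hcosh : ∀ t : ℝ, 1 + t ^ 2 ≤ Real.cosh (2 * t) := fun t => by
    have h := Real.cosh_sq t
    have h1 := Real.cosh_two_mul t
    have h2 : t ^ 2 ≤ Real.sinh t ^ 2 := by
      rw [sq_le_sq]
      rcases le_total 0 t with ht | ht
      · rw [abs_of_nonneg ht, abs_of_nonneg (Real.sinh_nonneg_iff.2 ht)]
        exact Real.self_le_sinh_iff.2 ht
      · rw [abs_of_nonpos ht, abs_of_nonpos (Real.sinh_nonpos_iff.2 ht)]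
        exact neg_le_neg (Real.sinh_le_self_iff.2 ht)
    nlinarith [sq_nonneg (Real.sinh t)]
  have hcosh4 : ∀ t : ℝ, (1 + t ^ 2) ^ 4 ≤ Real.cosh (8 * t) := fun t => by
    have h2 : ∀ s : ℝ, Real.cosh s ^ 2 ≤ Real.cosh (2 * s) := fun s => by
      rw [Real.cosh_two_mul]
      nlinarith [sq_nonneg (Real.sinh s)]
    calc (1 + t ^ 2) ^ 4 ≤ Real.cosh (2 * t) ^ 4 := pow_le_pow_left₀ (by positivity) (hcosh t) 4
      _ = (Real.cosh (2 * t) ^ 2) ^ 2 := by ring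
      _ ≤ Real.cosh (2 * (2 * t)) ^ 2 := pow_le_pow_left₀ (by positivity) (h2 _) 2
      _ ≤ Real.cosh (2 * (2 * (2 * t))) := h2 _
      _ = Real.cosh (8 * t) := by ring_nf
  have hprod : ∀ a : ℝ × ℝ, (1 + a.1 ^ 2) * (1 + a.2 ^ 2) ≤ √(Real.cosh (2 * (a.1 - a.2)) *
      Real.cosh (4 * (a.1 + a.2)) * Real.cosh (4 * (a.1 - a.2))) := fun a => by
    refine Real.le_sqrt_of_sq_le ?_
    have h1 : Real.cosh (4 * (a.1 + a.2)) * Real.cosh (4 * (a.1 - a.2)) =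
        (Real.cosh (8 * a.1) + Real.cosh (8 * a.2)) / 2 := by
      have e1 := Real.cosh_add (4 * (a.1 + a.2)) (4 * (a.1 - a.2))
      have e2 := Real.cosh_sub (4 * (a.1 + a.2)) (4 * (a.1 - a.2))
      rw [show 4 * (a.1 + a.2) + 4 * (a.1 - a.2) = 8 * a.1 by ring] at e1
      rw [show 4 * (a.1 + a.2) - 4 * (a.1 - a.2) = 8 * a.2 by ring] at e2
      rw [e1, e2]
      ring
    have h2 := Real.one_le_cosh (2 * (a.1 - a.2))
    rw [mul_assoc, h1]
    have h3 := hcosh4 a.1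
    have h4 := hcosh4 a.2
    have h5 := Real.cosh_pos (8 * a.1)
    have h6 := Real.cosh_pos (8 * a.2)
    calc ((1 + a.1 ^ 2) * (1 + a.2 ^ 2)) ^ 2
        ≤ ((1 + a.1 ^ 2) ^ 4 + (1 + a.2 ^ 2) ^ 4) / 2 := by
          nlinarith [sq_nonneg ((1 + a.1 ^ 2) ^ 2 - (1 + a.2 ^ 2) ^ 2)]
      _ ≤ (Real.cosh (8 * a.1) + Real.cosh (8 * a.2)) / 2 := by linarith
      _ ≤ _ := le_mul_of_one_le_left (by positivity) h2
  have hi : Integrable fun a : ℝ × ℝ => (1 + a.1 ^ 2)⁻¹ * (1 + a.2 ^ 2)⁻¹ :=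
    integrable_inv_one_add_sq.mul_prod integrable_inv_one_add_sq
  have hcont : Continuous fun a : ℝ × ℝ => ((√(Real.cosh (2 * (a.1 - a.2)) *
      Real.cosh (4 * (a.1 + a.2)) * Real.cosh (4 * (a.1 - a.2))) : ℝ) : ℂ) := by fun_prop
  refine hi.mono' (measurable_const.div hcont.measurable).aestronglyMeasurable
    (Filter.Eventually.of_forall fun a => ?_)
  rw [norm_div, norm_one, Complex.norm_real, Real.norm_of_nonneg (Real.sqrt_nonneg _),
    ← mul_inv, one_div]
  exact inv_anti₀ (by positivity) (hprod a)

/-! ### The multiplier of the squared Laplacian -/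

theorem exp₁_mul_exp₁_neg (x : AffSq) : exp₁ 1 x * exp₁ (-1) x = 1 := by
  rw [exp₁, exp₁, ← Complex.ofReal_mul, ← Real.exp_add]
  simp

theorem exp₂_mul_exp₂_neg (x : AffSq) : exp₂ 1 x * exp₂ (-1) x = 1 := by
  rw [exp₂, exp₂, ← Complex.ofReal_mul, ← Real.exp_add]
  simp

theorem phaseDeriv_inl_H : phaseDeriv (AffAlg.H, 0) = fun x => (pFun x : ℂ) + rFun x := by
  funext x
  simp [phaseDeriv, AffAlg.H, AffAlg.zero_fst, AffAlg.zero_snd]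

theorem phaseDeriv_inr_H : phaseDeriv (0, AffAlg.H) = fun x => (rFun x : ℂ) - pFun x := by
  funext x
  simp [phaseDeriv, AffAlg.H, AffAlg.zero_fst, AffAlg.zero_snd]

theorem phaseDeriv_inl_E :
    phaseDeriv (AffAlg.E, 0) = fun x => -((exp₂ 1 x - exp₂ (-1) x) / 2) := by
  funext x
  simp [phaseDeriv, AffAlg.E, AffAlg.zero_fst, AffAlg.zero_snd]

theorem phaseDeriv_inr_E :
    phaseDeriv (0, AffAlg.E) = fun x => (exp₁ 1 x - exp₁ (-1) x) / 2 := by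
  funext x
  simp [phaseDeriv, AffAlg.E, AffAlg.zero_fst, AffAlg.zero_snd]

/-- Conjugation of the Laplacian by the phase. -/
theorem mult_laplacian_mul {Q : Env} {F H₁ H₁₁ H₂ H₂₂ E₁ E₁₁ E₂ E₂₂ : AffSq → ℂ}
    (hQ : mult Scan Q = F)
    (h₁ : HasFieldDeriv (AffAlg.H, 0) F H₁) (h₁₁ : HasFieldDeriv (AffAlg.H, 0) H₁ H₁₁)
    (h₂ : HasFieldDeriv (0, AffAlg.H) F H₂) (h₂₂ : HasFieldDeriv (0, AffAlg.H) H₂ H₂₂)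
    (e₁ : HasFieldDeriv (AffAlg.E, 0) F E₁) (e₁₁ : HasFieldDeriv (AffAlg.E, 0) E₁ E₁₁)
    (e₂ : HasFieldDeriv (0, AffAlg.E) F E₂) (e₂₂ : HasFieldDeriv (0, AffAlg.E) E₂ E₂₂) :
    mult Scan (laplacian * Q) = fun x =>
      2 * (H₁₁ x + H₂₂ x + E₁₁ x + E₂₂ x - 2 * H₁ x - 2 * H₂ x) +
      4 * Complex.I * ((pFun x + rFun x) * H₁ x + (rFun x - pFun x) * H₂ x -
        (exp₂ 1 x - exp₂ (-1) x) / 2 * E₁ x + (exp₁ 1 x - exp₁ (-1) x) / 2 * E₂ x) +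
      (8 * Complex.I * (qFun x - 2 * rFun x) - 4 * (pFun x ^ 2 + rFun x ^ 2) -
        2 * ((exp₁ 1 x - exp₁ (-1) x) / 2) ^ 2 - 2 * ((exp₂ 1 x - exp₂ (-1) x) / 2) ^ 2) * F x := by
  have s₁ : HasFieldDeriv (AffAlg.H, 0) (phaseDeriv (AffAlg.H, 0))
      (fun x => 2 * ((qFun x : ℂ) - rFun x)) :=
    ((hasFieldDeriv_pFun _).add (hasFieldDeriv_rFun _)).congr phaseDeriv_inl_H (by
      funext x
      simp [AffAlg.H, AffAlg.zero_fst, AffAlg.zero_snd]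
      ring)
  have s₂ : HasFieldDeriv (0, AffAlg.H) (phaseDeriv (0, AffAlg.H))
      (fun x => 2 * ((qFun x : ℂ) - rFun x)) :=
    ((hasFieldDeriv_rFun _).sub (hasFieldDeriv_pFun _)).congr phaseDeriv_inr_H (by
      funext x
      simp [AffAlg.H, AffAlg.zero_fst, AffAlg.zero_snd]
      ring)
  have t₁ : HasFieldDeriv (AffAlg.E, 0) (phaseDeriv (AffAlg.E, 0)) (fun _ => 0) :=
    (((hasFieldDeriv_exp₂ _ 1).sub (hasFieldDeriv_exp₂ _ (-1))).const_mul (-1 / 2)).congr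
      (by rw [phaseDeriv_inl_E]; funext x; ring) (by funext x; simp [AffAlg.zero_fst])
  have t₂ : HasFieldDeriv (0, AffAlg.E) (phaseDeriv (0, AffAlg.E)) (fun _ => 0) :=
    (((hasFieldDeriv_exp₁ _ 1).sub (hasFieldDeriv_exp₁ _ (-1))).const_mul (1 / 2)).congr
      (by rw [phaseDeriv_inr_E]; funext x; ring) (by funext x; simp [AffAlg.zero_fst])
  have hL : laplacian * Q =
      (2 : ℝ) • (inl AffAlg.H * (inl AffAlg.H * Q) + inl AffAlg.E * (inl AffAlg.E * Q) -
        (2 : ℝ) • (inl AffAlg.H * Q)) +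
      (2 : ℝ) • (inr AffAlg.H * (inr AffAlg.H * Q) + inr AffAlg.E * (inr AffAlg.E * Q) -
        (2 : ℝ) • (inr AffAlg.H * Q)) := by
    simp only [laplacian, add_mul, sub_mul, smul_mul_assoc, sq, mul_assoc]
  rw [hL]
  simp only [mult_add, mult_smul, mult_sub, inl, inr]
  rw [mult_ι_mul_ι_mul hQ h₁ h₁₁ s₁, mult_ι_mul_ι_mul hQ h₂ h₂₂ s₂, mult_ι_mul_ι_mul hQ e₁ e₁₁ t₁,
    mult_ι_mul_ι_mul hQ e₂ e₂₂ t₂, mult_ι_mul hQ h₁, mult_ι_mul hQ h₂, phaseDeriv_inl_H,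
    phaseDeriv_inr_H, phaseDeriv_inl_E, phaseDeriv_inr_E]
  funext x
  push_cast
  ring

/-- The multiplier `-2 (2 (p² + r²) + D - 1) + 8 i (q - 2 r)` of the Laplacian. -/
noncomputable def lapMult (x : AffSq) : ℂ :=
  -2 * (2 * ((pFun x : ℂ) ^ 2 + (rFun x : ℂ) ^ 2) + ((exp₁ 1 x - exp₁ (-1) x) / 2) ^ 2 +
    ((exp₂ 1 x - exp₂ (-1) x) / 2) ^ 2) + 8 * Complex.I * (qFun x - 2 * rFun x)

theorem mult_laplacian : mult Scan laplacian = lapMult := by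
  rw [← mul_one laplacian, mult_laplacian_mul mult_one (.const _ 1) (.const _ 0) (.const _ 1)
    (.const _ 0) (.const _ 1) (.const _ 0) (.const _ 1) (.const _ 0)]
  funext x
  rw [lapMult]
  ring

theorem hasFieldDeriv_lapMult (X : AffSqAlg) : HasFieldDeriv X lapMult (fun x =>
    -2 * (4 * pFun x * (2 * (X.1.1 - X.2.1) * qFun x + X.1.2 * exp₂ 1 x + X.2.2 * exp₁ 1 x) +
      4 * rFun x *
        (-2 * (X.1.1 + X.2.1) * rFun x - X.1.2 * exp₂ (-1) x + X.2.2 * exp₁ (-1) x) +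
      X.1.1 * (exp₁ 1 x ^ 2 - exp₁ (-1) x ^ 2) + X.2.1 * (exp₂ 1 x ^ 2 - exp₂ (-1) x ^ 2)) +
    8 * Complex.I * (2 * (X.1.1 - X.2.1) * pFun x - X.1.2 * exp₂ 1 x + X.2.2 * exp₁ 1 x -
      2 * (-2 * (X.1.1 + X.2.1) * rFun x - X.1.2 * exp₂ (-1) x + X.2.2 * exp₁ (-1) x))) :=
  ((((((hasFieldDeriv_pFun X).sq.add (hasFieldDeriv_rFun X).sq).const_mul 2).add
    (((hasFieldDeriv_exp₁ X 1).sub (hasFieldDeriv_exp₁ X (-1))).const_mul (1 / 2)).sq).add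
    (((hasFieldDeriv_exp₂ X 1).sub (hasFieldDeriv_exp₂ X (-1))).const_mul (1 / 2)).sq).const_mul
    (-2)).add (((hasFieldDeriv_qFun X).sub ((hasFieldDeriv_rFun X).const_mul 2)).const_mul
      (8 * Complex.I)) |>.congr
    (by funext x; rw [lapMult]; ring) (by funext x; push_cast; ring)

theorem hasFieldDeriv_inl_H_lapMult : HasFieldDeriv (AffAlg.H, 0) lapMult (fun x =>
    -16 * (pFun x * qFun x) + 16 * rFun x ^ 2 - 2 * (exp₁ 1 x ^ 2 - exp₁ (-1) x ^ 2) +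
      Complex.I * (16 * pFun x + 32 * rFun x)) :=
  (hasFieldDeriv_lapMult _).congr rfl (by
    funext x
    simp [AffAlg.H, AffAlg.zero_fst, AffAlg.zero_snd]
    ring)

theorem hasFieldDeriv_inr_H_lapMult : HasFieldDeriv (0, AffAlg.H) lapMult (fun x =>
    16 * (pFun x * qFun x) + 16 * rFun x ^ 2 - 2 * (exp₂ 1 x ^ 2 - exp₂ (-1) x ^ 2) +
      Complex.I * (-16 * pFun x + 32 * rFun x)) :=
  (hasFieldDeriv_lapMult _).congr rfl (by
    funext x
    simp [AffAlg.H, AffAlg.zero_fst, AffAlg.zero_snd]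
    ring)

theorem hasFieldDeriv_inl_E_lapMult : HasFieldDeriv (AffAlg.E, 0) lapMult (fun x =>
    -8 * (pFun x * exp₂ 1 x) + 8 * (rFun x * exp₂ (-1) x) +
      8 * Complex.I * (-1 * exp₂ 1 x + 2 * exp₂ (-1) x)) :=
  (hasFieldDeriv_lapMult _).congr rfl (by
    funext x
    simp [AffAlg.E, AffAlg.zero_fst, AffAlg.zero_snd]
    ring)

theorem hasFieldDeriv_inr_E_lapMult : HasFieldDeriv (0, AffAlg.E) lapMult (fun x =>
    -8 * (pFun x * exp₁ 1 x) - 8 * (rFun x * exp₁ (-1) x) +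
      8 * Complex.I * (exp₁ 1 x - 2 * exp₁ (-1) x)) :=
  (hasFieldDeriv_lapMult _).congr rfl (by
    funext x
    simp [AffAlg.E, AffAlg.zero_fst, AffAlg.zero_snd]
    ring)

/-- The function `Z = D + 2 p² + 2 r²`; the real part of the multiplier of the Laplacian is
`-2 (Z - 1)`. -/
noncomputable def zFun (x : AffSq) : ℝ :=
  dFun (x.1.1, x.2.1) + 2 * pFun x ^ 2 + 2 * rFun x ^ 2

theorem dFun_eq_exp (a : ℝ × ℝ) : dFun a = (Real.exp (2 * a.1) ^ 2 + Real.exp (-(2 * a.1)) ^ 2 +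
    Real.exp (2 * a.2) ^ 2 + Real.exp (-(2 * a.2)) ^ 2) / 4 := by
  have i₁ : Real.exp (2 * a.1) * Real.exp (-(2 * a.1)) = 1 := by rw [← Real.exp_add]; simp
  have i₂ : Real.exp (2 * a.2) * Real.exp (-(2 * a.2)) = 1 := by rw [← Real.exp_add]; simp
  rw [dFun, Real.sinh_eq, Real.sinh_eq]
  linear_combination (-1 / 2) * i₁ + (-1 / 2) * i₂

theorem lapMult_eq (x : AffSq) :
    lapMult x = -2 * (zFun x - 1) + 8 * Complex.I * (qFun x - 2 * rFun x) := by
  rw [lapMult, zFun, dFun, ← ofReal_sinh₁, ← ofReal_sinh₂]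
  push_cast
  ring

/-- The multiplier of the squared Laplacian, up to lower order terms in its real and imaginary
parts. -/
theorem exists_mult_laplacian_sq (x : AffSq) : ∃ u v : ℝ,
    |u| ≤ 1000 * zFun x ∧ v ^ 2 ≤ 10 ^ 6 * zFun x ^ 3 ∧
    mult Scan (laplacian ^ 2) x =
      ((4 * zFun x ^ 2 - 192 * qFun x ^ 2 + 256 * qFun x * rFun x + u : ℝ) : ℂ) +
      ((-qFun x * (192 * pFun x ^ 2 + 64 * rFun x ^ 2 + 32 * dFun (x.1.1, x.2.1) - 160) + v : ℝ) :
        ℂ) * Complex.I := by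
  have h₁ := hasFieldDeriv_inl_H_lapMult
  have h₁₁ : HasFieldDeriv (AffAlg.H, 0) _ (fun x =>
      -32 * (pFun x ^ 2 + qFun x ^ 2) - 64 * rFun x ^ 2 - 8 * (exp₁ 1 x ^ 2 + exp₁ (-1) x ^ 2) +
        Complex.I * (32 * qFun x - 64 * rFun x)) :=
    (((((hasFieldDeriv_pFun _).mul (hasFieldDeriv_qFun _)).const_mul (-16)).add
      ((hasFieldDeriv_rFun _).sq.const_mul 16)).sub
      (((hasFieldDeriv_exp₁ _ 1).sq.sub (hasFieldDeriv_exp₁ _ (-1)).sq).const_mul 2)).add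
      ((((hasFieldDeriv_pFun _).const_mul 16).add ((hasFieldDeriv_rFun _).const_mul 32)).const_mul
        Complex.I) |>.congr rfl (by
      funext x
      simp [AffAlg.H, AffAlg.zero_fst, AffAlg.zero_snd]
      ring)
  have h₂ := hasFieldDeriv_inr_H_lapMult
  have h₂₂ : HasFieldDeriv (0, AffAlg.H) _ (fun x =>
      -32 * (pFun x ^ 2 + qFun x ^ 2) - 64 * rFun x ^ 2 - 8 * (exp₂ 1 x ^ 2 + exp₂ (-1) x ^ 2) +
        Complex.I * (32 * qFun x - 64 * rFun x)) :=
    (((((hasFieldDeriv_pFun _).mul (hasFieldDeriv_qFun _)).const_mul 16).add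
      ((hasFieldDeriv_rFun _).sq.const_mul 16)).sub
      (((hasFieldDeriv_exp₂ _ 1).sq.sub (hasFieldDeriv_exp₂ _ (-1)).sq).const_mul 2)).add
      ((((hasFieldDeriv_pFun _).const_mul (-16)).add
        ((hasFieldDeriv_rFun _).const_mul 32)).const_mul Complex.I) |>.congr rfl (by
      funext x
      simp [AffAlg.H, AffAlg.zero_fst, AffAlg.zero_snd]
      ring)
  have e₁ := hasFieldDeriv_inl_E_lapMult
  have e₁₁ : HasFieldDeriv (AffAlg.E, 0) _ (fun x => -8 * (exp₂ 1 x ^ 2 + exp₂ (-1) x ^ 2)) :=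
    ((((hasFieldDeriv_pFun _).mul (hasFieldDeriv_exp₂ _ 1)).const_mul (-8)).add
      (((hasFieldDeriv_rFun _).mul (hasFieldDeriv_exp₂ _ (-1))).const_mul 8)).add
      ((((hasFieldDeriv_exp₂ _ 1).const_mul (-1)).add
        ((hasFieldDeriv_exp₂ _ (-1)).const_mul 2)).const_mul (8 * Complex.I)) |>.congr rfl (by
      funext x
      simp [AffAlg.E, AffAlg.zero_fst, AffAlg.zero_snd]
      ring)
  have e₂ := hasFieldDeriv_inr_E_lapMult
  have e₂₂ : HasFieldDeriv (0, AffAlg.E) _ (fun x => -8 * (exp₁ 1 x ^ 2 + exp₁ (-1) x ^ 2)) :=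
    ((((hasFieldDeriv_pFun _).mul (hasFieldDeriv_exp₁ _ 1)).const_mul (-8)).sub
      (((hasFieldDeriv_rFun _).mul (hasFieldDeriv_exp₁ _ (-1))).const_mul 8)).add
      (((hasFieldDeriv_exp₁ _ 1).sub
        ((hasFieldDeriv_exp₁ _ (-1)).const_mul 2)).const_mul (8 * Complex.I)) |>.congr rfl (by
      funext x
      simp [AffAlg.E, AffAlg.zero_fst, AffAlg.zero_snd]
      ring)
  rw [sq, mult_laplacian_mul mult_laplacian h₁ h₁₁ h₂ h₂₂ e₁ e₁₁ e₂ e₂₂]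
  clear h₁ h₁₁ h₂ h₂₂ e₁ e₁₁ e₂ e₂₂
  have hD := dFun_eq_exp (x.1.1, x.2.1)
  have hD1 := one_le_dFun (x.1.1, x.2.1)
  have hZ : zFun x = dFun (x.1.1, x.2.1) + 2 * pFun x ^ 2 + 2 * rFun x ^ 2 := rfl
  have i₁ := exp₁_mul_exp₁_neg x
  have i₂ := exp₂_mul_exp₂_neg x
  have hs₁ : exp₁ 1 x = (Real.exp (2 * x.1.1) : ℝ) := by simp [exp₁]
  have hs₁' : exp₁ (-1) x = (Real.exp (-(2 * x.1.1)) : ℝ) := by simp [exp₁]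
  have hs₂ : exp₂ 1 x = (Real.exp (2 * x.2.1) : ℝ) := by simp [exp₂]
  have hs₂' : exp₂ (-1) x = (Real.exp (-(2 * x.2.1)) : ℝ) := by simp [exp₂]
  have hl := lapMult_eq x
  have hl0 : 8 * Complex.I * (qFun x - 2 * rFun x) - 4 * (pFun x ^ 2 + rFun x ^ 2) -
      2 * ((exp₁ 1 x - exp₁ (-1) x) / 2) ^ 2 - 2 * ((exp₂ 1 x - exp₂ (-1) x) / 2) ^ 2 =
      lapMult x := by
    rw [lapMult]
    ring
  simp only [hs₁, hs₁', hs₂, hs₂'] at *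
  generalize Real.exp (2 * x.1.1) = e₁ at *
  generalize Real.exp (2 * x.2.1) = e₂ at *
  generalize Real.exp (-(2 * x.1.1)) = f₁ at *
  generalize Real.exp (-(2 * x.2.1)) = f₂ at *
  generalize dFun (x.1.1, x.2.1) = D at *
  generalize zFun x = Z at *
  generalize lapMult x = μ at *
  generalize pFun x = p at *
  generalize qFun x = q at *
  generalize rFun x = r at *
  have hZD : D ≤ Z := by nlinarith [sq_nonneg p, sq_nonneg r]
  have he₁ := sq_nonneg e₁
  have he₂ := sq_nonneg e₂
  have hf₁ := sq_nonneg f₁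
  have hf₂ := sq_nonneg f₂
  have hp := sq_nonneg p
  have hr := sq_nonneg r
  refine ⟨-8 * Z + 4 - 896 * r ^ 2 - 256 * p ^ 2 - 128 * D +
    8 * (e₁ ^ 2 - f₁ ^ 2 + e₂ ^ 2 - f₂ ^ 2) -
    16 * (e₁ ^ 2 - 3 + 2 * f₁ ^ 2 + (e₂ ^ 2 - 3 + 2 * f₂ ^ 2)),
    r * (64 * (Z - 1) + 128 * r ^ 2 - 512 - 8 * (e₁ ^ 2 + e₂ ^ 2) + 24 * (f₁ ^ 2 + f₂ ^ 2) - 32) +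
    p * (24 * (e₂ ^ 2 - e₁ ^ 2) + 8 * (f₁ ^ 2 - f₂ ^ 2)), ?_, ?_, ?_⟩
  · rw [abs_le]
    constructor <;> linarith
  · generalize hA : 64 * (Z - 1) + 128 * r ^ 2 - 512 - 8 * (e₁ ^ 2 + e₂ ^ 2) +
      24 * (f₁ ^ 2 + f₂ ^ 2) - 32 = A
    generalize hB : 24 * (e₂ ^ 2 - e₁ ^ 2) + 8 * (f₁ ^ 2 - f₂ ^ 2) = B
    have hA2 : A ^ 2 ≤ (900 * Z) ^ 2 :=
      sq_le_sq' (by linarith) (by linarith)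
    have hB2 : B ^ 2 ≤ (100 * Z) ^ 2 :=
      sq_le_sq' (by linarith) (by linarith)
    have h1 : r ^ 2 * A ^ 2 ≤ Z / 2 * (900 * Z) ^ 2 :=
      mul_le_mul (by linarith) hA2 (sq_nonneg A) (by linarith)
    have h2 : p ^ 2 * B ^ 2 ≤ Z / 2 * (100 * Z) ^ 2 :=
      mul_le_mul (by linarith) hB2 (sq_nonneg B) (by linarith)
    have h3 : 0 ≤ Z ^ 3 := pow_nonneg (by linarith) 3
    have h4 : (r * A + p * B) ^ 2 ≤ 2 * (r ^ 2 * A ^ 2) + 2 * (p ^ 2 * B ^ 2) := by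
      linarith [sq_nonneg (r * A - p * B)]
    linarith
  · have hZc : (Z : ℂ) = D + 2 * p ^ 2 + 2 * r ^ 2 := by exact_mod_cast hZ
    have hDc : (D : ℂ) = (e₁ ^ 2 + f₁ ^ 2 + e₂ ^ 2 + f₂ ^ 2) / 4 := by exact_mod_cast hD
    have hI := Complex.I_sq
    rw [hl0, hl]
    push_cast
    rw [hZc, hDc]
    linear_combination (2 * Complex.I * (-8 * r + 8 * p - 24 * Complex.I)) * i₁ +
      (-2 * Complex.I * (8 * r + 8 * p + 24 * Complex.I)) * i₂ +
      (4 * (32 * p ^ 2 + 64 * r ^ 2) + 16 * (e₂ ^ 2 + 2 * f₂ ^ 2 - 3 + (e₁ ^ 2 + 2 * f₁ ^ 2 - 3)) +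
        64 * (q - 2 * r) ^ 2) * hI

/-- The lower bound for the modulus of `C + 4 Z² - 192 q² + 256 q r + O(Z)
- i (q (192 p² + 64 r² + 32 D - 160) + O(Z^{3/2}))`. If `256 q²` is at most `C / 2 + 3 Z²`, the real
part is large; otherwise `Z`, which bounds `q`, is large too, and so is the imaginary part. -/
theorem half_sq_le_abs_or {p q r D Z C u v : ℝ} (hD : 1 ≤ D) (hZ : Z = D + 2 * p ^ 2 + 2 * r ^ 2)
    (hC : C = 10 ^ 22) (hq : q ^ 2 ≤ 2 * p ^ 2 + 8 * r ^ 2 * D ^ 2) (hu : |u| ≤ 1000 * Z)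
    (hv : v ^ 2 ≤ 10 ^ 6 * Z ^ 3) :
    Z ^ 2 / 2 ≤ |C + 4 * Z ^ 2 - 192 * q ^ 2 + 256 * q * r + u| ∨
      Z ^ 2 / 2 ≤ |-q * (192 * p ^ 2 + 64 * r ^ 2 + 32 * D - 160) + v| := by
  have hp0 := sq_nonneg p
  have hr0 := sq_nonneg r
  have hZ1 : 1 ≤ Z := by nlinarith
  by_cases h : 256 * q ^ 2 ≤ C / 2 + 3 * Z ^ 2
  · left
    -- `256 q r ≥ -64 q² - 256 r²`, and `C / 2` absorbs the terms linear in `Z`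
    refine le_trans ?_ (le_abs_self _)
    have hu' := (abs_le.1 hu).1
    nlinarith [sq_nonneg (q + 2 * r), sq_nonneg (Z - 1128)]
  · right
    push Not at h
    have hD2 : D ^ 2 ≤ Z ^ 2 := pow_le_pow_left₀ (by linarith) (by nlinarith) 2
    have hZ3 : Z ≤ Z ^ 3 := le_self_pow₀ hZ1 (by norm_num)
    have hq5 : q ^ 2 ≤ 5 * Z ^ 3 := by
      have h1 : r ^ 2 * D ^ 2 ≤ Z / 2 * Z ^ 2 :=
        mul_le_mul (by linarith) hD2 (sq_nonneg D) (by linarith)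
      nlinarith
    -- `C / 2 < 256 q² ≤ 1280 Z³`, so the size of `C` makes `Z` large
    have hZ0 : 10 ^ 6 ≤ Z := by
      by_contra hlt
      push Not at hlt
      have h3 : Z ^ 3 ≤ (10 ^ 6) ^ 3 := pow_le_pow_left₀ (by linarith) hlt.le 3
      nlinarith [sq_nonneg Z]
    have hqZ : Z / 10 ≤ |q| := by
      refine le_of_pow_le_pow_left₀ (n := 2) two_ne_zero (abs_nonneg q) ?_
      rw [sq_abs]
      nlinarith [sq_nonneg Z]
    have hvZ : |v| ≤ Z ^ 2 := by
      refine abs_le_of_sq_le_sq (hv.trans ?_) (by positivity)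
      have : 0 ≤ Z ^ 3 := by positivity
      nlinarith
    have hg : 16 * Z ≤ 192 * p ^ 2 + 64 * r ^ 2 + 32 * D - 160 := by nlinarith
    have hqg : Z / 10 * (16 * Z) ≤ |q| * (192 * p ^ 2 + 64 * r ^ 2 + 32 * D - 160) :=
      mul_le_mul hqZ hg (by positivity) (abs_nonneg q)
    have habs : |-q * (192 * p ^ 2 + 64 * r ^ 2 + 32 * D - 160)| =
        |q| * (192 * p ^ 2 + 64 * r ^ 2 + 32 * D - 160) := by
      rw [abs_mul, abs_neg,
        abs_of_nonneg (a := 192 * p ^ 2 + 64 * r ^ 2 + 32 * D - 160) (by linarith)]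
    have := abs_sub_abs_le_abs_add (-q * (192 * p ^ 2 + 64 * r ^ 2 + 32 * D - 160)) v
    nlinarith

/-- The multiplier of `C + L²`, for the Laplacian `L` and `C` large, has modulus at least
`Z² / 2`. -/
theorem exists_half_sq_le_norm_mult : ∃ C : ℝ, 0 < C ∧ ∀ x,
    zFun x ^ 2 / 2 ≤ ‖mult Scan (algebraMap ℝ Env C + laplacian ^ 2) x‖ := by
  refine ⟨10 ^ 22, by norm_num, fun x => ?_⟩
  obtain ⟨u, v, hu, hv, h⟩ := exists_mult_laplacian_sq x
  have hC : mult Scan (algebraMap ℝ Env (10 ^ 22) + laplacian ^ 2) x =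
      ((10 ^ 22 + 4 * zFun x ^ 2 - 192 * qFun x ^ 2 + 256 * qFun x * rFun x + u : ℝ) : ℂ) +
      ((-qFun x * (192 * pFun x ^ 2 + 64 * rFun x ^ 2 + 32 * dFun (x.1.1, x.2.1) - 160) + v : ℝ) :
        ℂ) * Complex.I := by
    rw [mult_add, Algebra.algebraMap_eq_smul_one, mult_smul, mult_one]
    simp only [h]
    push_cast
    ring
  rw [hC]
  rcases half_sq_le_abs_or (one_le_dFun (x.1.1, x.2.1)) (Z := zFun x) rfl rfl (qFun_sq_le x) hu hv
    with h' | h'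
  · refine h'.trans ((le_of_eq ?_).trans (Complex.abs_re_le_norm _))
    simp only [Complex.add_re, Complex.ofReal_re, Complex.re_ofReal_mul, Complex.I_re]
    ring_nf
  · refine h'.trans ((le_of_eq ?_).trans (Complex.abs_im_le_norm _))
    simp only [Complex.add_im, Complex.ofReal_im, Complex.im_ofReal_mul, Complex.I_im]
    ring_nf

/-! ### Integrability of the quotients -/

/-- The bound `p² + r⁴ + D⁴ ≥ ((D² + r²)² + p²) / 2` reduces the claim to `integrable_div`. -/
theorem integrable_div_mult_adaptedOp {w : ℝ × ℝ → ℂ} (hw : Continuous w)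
    (hwi : IntegrabilityCondition w) :
    Integrable fun x : AffSq => w (x.1.1, x.2.1) / mult Scan adaptedOp x := by
  have hD : ∀ a, 0 < dFun a := fun a => zero_lt_one.trans_le (one_le_dFun a)
  refine integrable_div (contDiff_mult _).continuous isWeight_mult_adaptedOp.1
    (α := fun _ _ => 1 / 2) (β := fun a r => dFun a ^ 2 + r ^ 2) (γ := fun _ => 1) (δ := dFun)
    (fun a => by fun_prop) (fun a => by fun_prop) (fun _ _ => by norm_num)
    (fun a r => by have := hD a; positivity) (fun _ => one_pos) hD (fun a => one_mul _)
    (fun a r => by linarith) (fun x => (le_trans ?_ (weightFun_le_norm_mult x))) hw hwi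
  rw [weightFun]
  nlinarith [sq_nonneg (dFun (x.1.1, x.2.1) ^ 2 - rFun x ^ 2), sq_nonneg (pFun x)]

/-- The bound `Z² ≥ (D + r²) (D + p²)` reduces the claim to `integrable_div`. -/
theorem integrable_div_of_half_sq_le {M : AffSq → ℂ} (hM : Continuous M)
    (hle : ∀ x, zFun x ^ 2 / 2 ≤ ‖M x‖) (hM0 : ∀ x, M x ≠ 0)
    {w : ℝ × ℝ → ℂ} (hw : Continuous w) (hwi : IntegrabilityCondition w) :
    Integrable fun x : AffSq => w (x.1.1, x.2.1) / M x := by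
  have hD : ∀ a, 0 < dFun a := fun a => zero_lt_one.trans_le (one_le_dFun a)
  have hs : ∀ a, √(dFun a) ^ 2 = dFun a := fun a => Real.sq_sqrt (hD a).le
  refine integrable_div hM hM0
    (α := fun a r => (dFun a + r ^ 2) / 2) (β := fun a _ => √(dFun a))
    (γ := fun a => √(dFun a)) (δ := fun a => √(dFun a))
    (fun a => by fun_prop) (fun a => by fun_prop)
    (fun a r => by have := hD a; positivity) (fun a r => Real.sqrt_pos.2 (hD a))
    (fun a => Real.sqrt_pos.2 (hD a)) (fun a => Real.sqrt_pos.2 (hD a))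
    (fun a => by rw [← sq, hs]) (fun a r => by rw [hs]; linarith)
    (fun x => (le_trans ?_ (hle x))) hw hwi
  rw [hs, zFun]
  have h1 := (hD (x.1.1, x.2.1)).le
  have h2 := sq_nonneg (pFun x)
  have h3 := sq_nonneg (rFun x)
  nlinarith [mul_nonneg h1 h2, mul_nonneg h1 h3, mul_nonneg h2 h3, sq_nonneg (pFun x ^ 2),
    sq_nonneg (rFun x ^ 2)]

theorem isAdapted_adaptedOp : IsAdapted Scan adaptedOp :=
  ⟨isWeight_mult_adaptedOp, integrable_div_mult_adaptedOp continuous_const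
    integrabilityCondition_one⟩

end AffSq

theorem mainTheorem6 :
    AffSq.IsPhase AffSq.Scan ∧
    (∃ P : AffSq.Env, AffSq.IsAdapted AffSq.Scan P ∧
      ∀ w : ℝ × ℝ → ℂ, AffSq.IsWeight (fun x => w (x.1.1, x.2.1)) →
        AffSq.IntegrabilityCondition w →
        AffSq.IsAmplitudeWeight AffSq.Scan P (fun x => w (x.1.1, x.2.1)) ∧
        ∀ A ∈ AffSq.symbolSpace (fun x => w (x.1.1, x.2.1)),
          AffSq.IsAmplitude AffSq.Scan P A) ∧
    (∃ C : ℝ, 0 < C ∧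
      (∀ x, AffSq.mult AffSq.Scan (algebraMap ℝ AffSq.Env C + AffSq.laplacian ^ 2) x ≠ 0) ∧
      MeasureTheory.Integrable (fun x =>
        1 / AffSq.mult AffSq.Scan (algebraMap ℝ AffSq.Env C + AffSq.laplacian ^ 2) x) ∧
      ∀ w : ℝ × ℝ → ℂ, AffSq.IsWeight (fun x => w (x.1.1, x.2.1)) →
        AffSq.IntegrabilityCondition w →
        MeasureTheory.Integrable (fun x => w (x.1.1, x.2.1) /
          AffSq.mult AffSq.Scan (algebraMap ℝ AffSq.Env C + AffSq.laplacian ^ 2) x)) := by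
  refine ⟨⟨AffSq.adaptedOp, AffSq.isAdapted_adaptedOp⟩,
    ⟨AffSq.adaptedOp, AffSq.isAdapted_adaptedOp, fun w hw hwi => ?_⟩, ?_⟩
  · have h : AffSq.IsAmplitudeWeight AffSq.Scan AffSq.adaptedOp (fun x => w (x.1.1, x.2.1)) :=
      ⟨hw, AffSq.integrable_div_mult_adaptedOp (AffSq.continuous_of_isWeight hw) hwi⟩
    exact ⟨h, fun A hA => ⟨_, h, hA⟩⟩
  · obtain ⟨C, hC, hle⟩ := AffSq.exists_half_sq_le_norm_mult
    have hc := (AffSq.contDiff_mult (algebraMap ℝ AffSq.Env C + AffSq.laplacian ^ 2)).continuous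
    have hne : ∀ x,
        AffSq.mult AffSq.Scan (algebraMap ℝ AffSq.Env C + AffSq.laplacian ^ 2) x ≠ 0 := by
      intro x hx
      have h := hle x
      rw [hx, norm_zero, AffSq.zFun] at h
      have := AffSq.one_le_dFun (x.1.1, x.2.1)
      nlinarith [sq_nonneg (AffSq.pFun x), sq_nonneg (AffSq.rFun x)]
    exact ⟨C, hC, hne,
      AffSq.integrable_div_of_half_sq_le hc hle hne continuous_const
        AffSq.integrabilityCondition_one,
      fun w hw hwi =>
        AffSq.integrable_div_of_half_sq_le hc hle hne (AffSq.continuous_of_isWeight hw) hwi⟩
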